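/- Points of space-time are written $(x,t)\in\mathbb R^d\times\mathbb R$; $D_x^\alpha$ and $\nabla$ denote (weak) spatial derivatives and $\partial_t$ the (weak) time derivative. For an open set $W\subseteq\mathbb R^d\times\mathbb R$ and $k,l,m\in\mathbb N_0$ let $$\|w\|_{H^{k,l}(W)}^2=\sum_{|\alpha|/k+p/l\le 1}\|\partial_t^pD_x^\alpha w\|_{L^2(W)}^2,\qquad \|w\|_{H^{k,l,\infty}(W)}=\max_{|\alpha|/k+p/l\le 1}\|\partial_t^pD_x^\alpha w\|_{L^\infty(W)},$$ where $0/0=0$ and $q/0=\infty$ for $q>0$ (so $H^{0,l}$ involves only $\partial_t^p$, $p\le l$, and $H^{k,0}$ only $D_x^\alpha$, $|\alpha|\le k$), and $\|w\|_{H^m(W)}^2=\sum_{|\alpha|+p\le m}\|\partial_t^pD_x^\alpha w\|_{L^2(W)}^2$. A norm is $\infty$ if one of the weak derivatives does not exist. Let $d,l_s,l_t\in\mathbb N_0$ and $M,L\ge 0$. Consider an open set $E\subseteq\mathbb R^d\times\mathbb R$ and a map $\Psi:E\to\mathbb R^d$ such that $\Psi^{st}(x,t):=(\Psi(x,t),t)$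 is continuous on $E$, its image $\Psi^{st}(E)$ is open, and for every $t$ the map $\Psi(\cdot,t)$ is injective with $L$-Lipschitz inverse, i.e. $|x-y|\le L\,|\Psi(x,t)-\Psi(y,t)|$ for $(x,t),(y,t)\in E$. Let $u^e:\Psi^{st}(E)\to\mathbb R$. Then the following hold with constants $C$ that depend only on $d,l_s,l_t,M,L$ (and not on $E$, $\Psi$, $u^e$). 1. If $\|\Psi^{st}\|_{H^{0,l_t,\infty}(E)}\le M$, then $\|u^e\circ\Psi^{st}\|_{H^{0,l_t}(E)}\le C\,\|u^e\|_{H^{l_t}(\Psi^{st}(E))}$. 2. If $\|\Psi^{st}\|_{H^{l_s,0,\infty}(E)}\le M$, then $\|u^e\circ\Psi^{st}\|_{H^{l_s,0}(E)}\le C\,\|u^e\|_{H^{l_s}(\Psi^{st}(E))}$. 3. If $\|\Psi^{st}\|_{H^{l_s,0,\infty}(E)}+\|\partial_t\Psi^{st}\|_{H^{l_s,0,\infty}(E)}\le M$, then $\|\partial_t(u^e\circ\Psi^{st})\|_{H^{l_s,0}(E)}\le C\,\|u^e\|_{H^{l_s+1}(\Psi^{st}(E))}$. 4. If $\|\Psi^{st}\|_{H^{0,l_t,\infty}(E)}+\|\nabla\Psi^{st}\|_{H^{0,l_t,\infty}(E)}\le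 M$, then $\|\nabla(u^e\circ\Psi^{st})\|_{H^{0,l_t}(E)}\le C\,\|u^e\|_{H^{l_t+1}(\Psi^{st}(E))}$. -/

import Mathlib

open MeasureTheory Set
open scoped ENNReal NNReal ContDiff

noncomputable section

namespace AnisoSobolev

/-- Points `(x, t)` of space-time, with `d` space dimensions. -/
abbrev ST (d : ℕ) : Type := EuclideanSpace ℝ (Fin d) × ℝ

/-- A space-time multi-index `(α, p)` stands for the operator `∂ₜ^p D_x^α`. -/
abbrev MIdx (d : ℕ) : Type := (Fin d → ℕ) × ℕ

/-- The order `|α|` of the spatial part of a multi-index. -/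
def spaceOrder {d : ℕ} (a : MIdx d) : ℕ := ∑ i, a.1 i

/-- The total order `|α| + p`. -/
def totalOrder {d : ℕ} (a : MIdx d) : ℕ := spaceOrder a + a.2

/-- The multi-index of `∂ₜ`. -/
def idxT (d : ℕ) : MIdx d := (0, 1)

/-- The multi-index of `∂/∂xᵢ`. -/
def idxX {d : ℕ} (i : Fin d) : MIdx d := (Pi.single i 1, 0)

/-- Classical partial derivative in the direction `xᵢ`. -/
def partialX {d : ℕ} (i : Fin d) (g : ST d → ℝ) : ST d → ℝ :=
  fun z => fderiv ℝ g z (EuclideanSpace.single i 1, 0)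

/-- Classical partial derivative in time. -/
def partialT {d : ℕ} (g : ST d → ℝ) : ST d → ℝ :=
  fun z => fderiv ℝ g z (0, 1)

/-- The classical operator `D_x^α ∂ₜ^p`; it is applied to smooth functions only. -/
def classicalDeriv {d : ℕ} (a : MIdx d) (g : ST d → ℝ) : ST d → ℝ :=
  (List.finRange d).foldr (fun i f => (partialX i)^[a.1 i] f) (partialT^[a.2] g)

/-- `v` is the weak derivative `∂ₜ^p D_x^α w` on the open set `W`. -/
def HasWeakDeriv {d : ℕ} {F : Type*} [NormedAddCommGroup F] [NormedSpace ℝ F]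
    (W : Set (ST d)) (a : MIdx d) (w v : ST d → F) : Prop :=
  LocallyIntegrableOn w W ∧ LocallyIntegrableOn v W ∧
    ∀ φ : ST d → ℝ, ContDiff ℝ ∞ φ → HasCompactSupport φ → tsupport φ ⊆ W →
      ∫ z in W, classicalDeriv a φ z • w z = (-1 : ℝ) ^ totalOrder a • ∫ z in W, φ z • v z

/-- The `L^r(W)` norm of the weak derivative `∂ₜ^p D_x^α w`. It is `∞` if there is no such
derivative; as weak derivatives are unique almost everywhere, the infimum is over one value. -/
def weakDerivNorm {d : ℕ} {F : Type*} [NormedAddCommGroup F] [NormedSpace ℝ F]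
    (r : ℝ≥0∞) (W : Set (ST d)) (a : MIdx d) (w : ST d → F) : ℝ≥0∞ :=
  ⨅ (v : ST d → F) (_ : HasWeakDeriv W a w v), eLpNorm v r (volume.restrict W)

open Classical in
/-- The multi-indices with `|α| / k + p / l ≤ 1`. Division is that of `[0, ∞]`, where `0 / 0 = 0`
and `q / 0 = ∞` for `q > 0`: for `k = 0` there are no spatial derivatives, for `l = 0` no
temporal ones. The product only serves to bound the multi-indices a priori. -/
def anisoIdx (d k l : ℕ) : Finset (MIdx d) :=
  ((Fintype.piFinset fun _ : Fin d => Finset.range (k + 1)) ×ˢ Finset.range (l + 1)).filter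
    fun a => (spaceOrder a : ℝ≥0∞) / (k : ℝ≥0∞) + (a.2 : ℝ≥0∞) / (l : ℝ≥0∞) ≤ 1

/-- The multi-indices of total order at most `m`. -/
def isoIdx (d m : ℕ) : Finset (MIdx d) :=
  ((Fintype.piFinset fun _ : Fin d => Finset.range (m + 1)) ×ˢ Finset.range (m + 1)).filter
    fun a => totalOrder a ≤ m

/-- `(∑ ‖∂ₜ^p D_x^α w‖²_{L²(W)})^{1/2}` over the multi-indices in `S`; it is finite iff all
these weak derivatives exist and lie in `L²(W)`. -/
def normL2 {d : ℕ} {F : Type*} [NormedAddCommGroup F] [NormedSpace ℝ F]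
    (S : Finset (MIdx d)) (W : Set (ST d)) (w : ST d → F) : ℝ≥0∞ :=
  (∑ a ∈ S, weakDerivNorm 2 W a w ^ 2) ^ (1 / 2 : ℝ)

/-- `max ‖∂ₜ^p D_x^α w‖_{L^∞(W)}` over the multi-indices in `S`. -/
def normLinf {d : ℕ} {F : Type*} [NormedAddCommGroup F] [NormedSpace ℝ F]
    (S : Finset (MIdx d)) (W : Set (ST d)) (w : ST d → F) : ℝ≥0∞ :=
  S.sup fun a => weakDerivNorm ∞ W a w

/-- The norm of `H^m(W)`. -/
def normH {d : ℕ} (m : ℕ) (W : Set (ST d)) (w : ST d → ℝ) : ℝ≥0∞ :=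
  normL2 (isoIdx d m) W w

/-- The norm of the anisotropic space `H^{k,l}(W)`. -/
def normHaniso {d : ℕ} (k l : ℕ) (W : Set (ST d)) (w : ST d → ℝ) : ℝ≥0∞ :=
  normL2 (anisoIdx d k l) W w

/-- The norm of the weak time derivative `∂ₜ w` in `H^{k,l}(W)`. -/
def normHanisoDt {d : ℕ} (k l : ℕ) (W : Set (ST d)) (w : ST d → ℝ) : ℝ≥0∞ :=
  ⨅ (v : ST d → ℝ) (_ : HasWeakDeriv W (idxT d) w v), normHaniso k l W v

/-- The norm of the weak spatial gradient `∇ w` in `H^{k,l}(W)`. -/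
def normHanisoGrad {d : ℕ} (k l : ℕ) (W : Set (ST d)) (w : ST d → ℝ) : ℝ≥0∞ :=
  (∑ i : Fin d,
    (⨅ (v : ST d → ℝ) (_ : HasWeakDeriv W (idxX i) w v), normHaniso k l W v) ^ 2) ^ (1 / 2 : ℝ)

/-- The norm of `H^{k,l,∞}(W)`: as for `H^{k,l}(W)`, with `L^∞` in place of `L²`, for maps into
space-time. -/
def normHinf {d : ℕ} (k l : ℕ) (W : Set (ST d)) (w : ST d → ST d) : ℝ≥0∞ :=
  normLinf (anisoIdx d k l) W w

/-- The norm of the weak time derivative `∂ₜ w` in `H^{k,l,∞}(W)`. -/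
def normHinfDt {d : ℕ} (k l : ℕ) (W : Set (ST d)) (w : ST d → ST d) : ℝ≥0∞ :=
  ⨅ (v : ST d → ST d) (_ : HasWeakDeriv W (idxT d) w v), normHinf k l W v

/-- The norm of the weak spatial gradient `∇ w` in `H^{k,l,∞}(W)`. -/
def normHinfGrad {d : ℕ} (k l : ℕ) (W : Set (ST d)) (w : ST d → ST d) : ℝ≥0∞ :=
  Finset.univ.sup fun i : Fin d =>
    ⨅ (v : ST d → ST d) (_ : HasWeakDeriv W (idxX i) w v), normHinf k l W v

/-- The space-time variant `Ψˢᵗ(x, t) = (Ψ(x, t), t)` of a mapping `Ψ`. -/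
def spaceTimeMap {d : ℕ} (Ψ : ST d → EuclideanSpace ℝ (Fin d)) : ST d → ST d :=
  fun z => (Ψ z, z.2)

/-- `Ψˢᵗ` is a continuous map of the open set `E` onto an open set, and each `Ψ(·, t)` is
injective with an `L`-Lipschitz inverse. -/
structure IsDeformation {d : ℕ} (L : ℝ≥0) (E : Set (ST d))
    (Ψ : ST d → EuclideanSpace ℝ (Fin d)) : Prop where
  isOpen_domain : IsOpen E
  continuousOn : ContinuousOn (spaceTimeMap Ψ) E
  isOpen_image : IsOpen (spaceTimeMap Ψ '' E)
  antilipschitz : ∀ (t : ℝ) (x y : EuclideanSpace ℝ (Fin d)), (x, t) ∈ E → (y, t) ∈ E →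
    ‖x - y‖ ≤ L * ‖Ψ (x, t) - Ψ (y, t)‖

end AnisoSobolev

end

/-! Write `Φ` for the space-time map. It preserves `t`, and its slices have `L`-Lipschitz inverses,
which enlarge `d`-dimensional Hausdorff measure by at most `L ^ d`. By Fubini, preimages under `Φ`
have measure at most `L ^ d` times that of the set (`IsDeformation.isPullbackMap`). Hence `w ↦ w ∘
Φ` is bounded on `L²` and on `L¹` over compact sets, with no differentiability of `Φ` and no
Jacobian involved.

The chain rule `∂ₑ(u ∘ Φ) = ∑ⱼ (∂ⱼu ∘ Φ) ∂ₑΦⱼ` is needed in one direction `e` at a time, since `Φ`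
may be weakly differentiable in some directions only. For smooth `u` it follows by mollifying `Φ`,
whose values and `e`-derivative are bounded, and using dominated convergence
(`IsWeakDirDeriv.contDiff_comp`). For Sobolev `u` one mollifies `u` near the compact set `Φ(K)`,
with `K` the support of the test function, and passes to the limit in `L¹` by the measure bound
(`IsWeakDirDeriv.comp`).

Higher orders need no Faà di Bruno formula. `SobolevBound` describes regularity recursively through
first derivatives in the directions of a set `S` (time only, or space only). In the chain rule, `∂ⱼu
∘ Φ` is controlled by induction and `∂ₑΦⱼ` is a bounded multiplier, so the Leibniz bound
`SobolevBound.mul` closes the induction. The outer function is differentiated in all directions,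
whence the isotropic norm on the right. The two mixed estimates apply the same chain-rule step,
`exists_hasWeakDeriv_comp`, once more, with `e` outside `S`. Commuting classical derivatives of test
functions translates between multi-index norms and this recursion. -/

namespace AnisoSobolev

open Filter Topology Metric
open scoped Convolution

/-! ### Mollifiers and weak directional derivatives. -/

section Mollification

/-- A standard sequence of bump functions that shrink to the origin. -/
noncomputable def bumpSeq (G : Type*) [NormedAddCommGroup G] (n : ℕ) : ContDiffBump (0 : G) where
  rIn := 1 / ((n : ℝ) + 1)
  rOut := 2 / ((n : ℝ) + 1)
  rIn_pos := by positivity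
  rIn_lt_rOut := by gcongr; norm_num

lemma tendsto_rOut_bumpSeq {G : Type*} [NormedAddCommGroup G] :
    Tendsto (fun n => (bumpSeq G n).rOut) atTop (𝓝 0) := by
  have := (tendsto_one_div_add_atTop_nhds_zero_nat (𝕜 := ℝ)).const_mul 2
  simpa [bumpSeq, div_eq_mul_inv] using this

variable {G : Type*} [NormedAddCommGroup G] [NormedSpace ℝ G] [FiniteDimensional ℝ G]
  [MeasureSpace G] [BorelSpace G] [(volume : Measure G).IsAddHaarMeasure]
variable {F : Type*} [NormedAddCommGroup F] [NormedSpace ℝ F]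

/-- `g` is the weak derivative of `f` in the direction `v` on `W`. -/
structure IsWeakDirDeriv (W : Set G) (v : G) (f g : G → F) : Prop where
  left : LocallyIntegrableOn f W
  right : LocallyIntegrableOn g W
  integral_eq : ∀ φ : G → ℝ, ContDiff ℝ ∞ φ → HasCompactSupport φ → tsupport φ ⊆ W →
    ∫ z in W, fderiv ℝ φ z v • f z = -∫ z in W, φ z • g z

/-- The convolution of `f`, cut off outside `K`, with a normalized bump function. -/
noncomputable def mollify (ρ : ContDiffBump (0 : G)) (K : Set G) (f : G → F) : G → F :=
  ρ.normed volume ⋆[ContinuousLinearMap.lsmul ℝ ℝ, volume] K.indicator f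

variable {K W : Set G} {f g : G → F} {ρ : ContDiffBump (0 : G)} {v x : G}

lemma contDiff_mollify (hK : MeasurableSet K) (hf : IntegrableOn f K) :
    ContDiff ℝ ∞ (mollify ρ K f) :=
  ρ.hasCompactSupport_normed.contDiff_convolution_left _ ρ.contDiff_normed
    ((integrable_indicator_iff hK).2 hf).locallyIntegrable

/-- The normalized bump is a probability density, so this is a bound on an average. -/
lemma norm_mollify_le {B : ℝ} (hB : 0 ≤ B) (hK : MeasurableSet K)
    (hf : ∀ᵐ y ∂volume.restrict K, ‖f y‖ ≤ B) : ‖mollify ρ K f x‖ ≤ B := by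
  have h : ∀ᵐ y, ‖K.indicator f y‖ ≤ B := by
    filter_upwards [(ae_restrict_iff' hK).1 hf] with y hy
    by_cases hyK : y ∈ K
    · simpa [hyK] using hy hyK
    · simpa [hyK] using hB
  have h' : ∀ᵐ t, ‖K.indicator f (x - t)‖ ≤ B :=
    (quasiMeasurePreserving_sub_left volume x).ae h
  calc ‖mollify ρ K f x‖ ≤ ∫ t, ρ.normed volume t * B := by
        refine norm_integral_le_of_norm_le (ρ.integrable_normed.mul_const B) ?_
        filter_upwards [h'] with t ht
        simp only [ContinuousLinearMap.lsmul_apply, norm_smul, Real.norm_eq_abs,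
          abs_of_nonneg (ρ.nonneg_normed t)]
        exact mul_le_mul_of_nonneg_left ht (ρ.nonneg_normed t)
    _ = B := by rw [integral_mul_const, ρ.integral_normed, one_mul]

lemma ae_tendsto_mollify [CompleteSpace F] (hK : MeasurableSet K) (hf : IntegrableOn f K) :
    ∀ᵐ y ∂volume.restrict K, Tendsto (fun n => mollify (bumpSeq G n) K f y) atTop (𝓝 (f y)) := by
  rw [ae_restrict_iff' hK]
  -- Lebesgue differentiation requires `rOut ≤ K * rIn`; the bumps of `bumpSeq` have ratio exactly
  -- `2`.
  have := ContDiffBump.ae_convolution_tendsto_right_of_locallyIntegrable (K := 2)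
    (φ := bumpSeq G) (l := atTop) (μ := volume) tendsto_rOut_bumpSeq
    (Eventually.of_forall fun n => by simp [bumpSeq, div_eq_mul_inv])
    ((integrable_indicator_iff hK).2 hf).locallyIntegrable
  filter_upwards [this] with y hy hyK
  simpa [hyK, mollify] using hy

/-- Young's inequality for `L¹`, by Tonelli, translation invariance and the unit mass of the bump.
-/
lemma lintegral_enorm_convolution_normed_le {h : G → F} (hh : AEStronglyMeasurable h volume) :
    ∫⁻ x, ‖(ρ.normed volume ⋆[ContinuousLinearMap.lsmul ℝ ℝ, volume] h) x‖ₑ ≤ ∫⁻ x, ‖h x‖ₑ := by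
  have hρ : ∫⁻ t, ‖ρ.normed volume t‖ₑ = 1 := by
    rw [← ofReal_integral_norm_eq_lintegral_enorm ρ.integrable_normed]
    simp [abs_of_nonneg (ρ.nonneg_normed _), ρ.integral_normed]
  calc ∫⁻ x, ‖(ρ.normed volume ⋆[ContinuousLinearMap.lsmul ℝ ℝ, volume] h) x‖ₑ
      ≤ ∫⁻ x, ∫⁻ t, ‖ρ.normed volume t‖ₑ * ‖h (x - t)‖ₑ := by
        refine lintegral_mono fun x => (enorm_integral_le_lintegral_enorm _).trans_eq ?_
        simp [enorm_smul]
    _ = ∫⁻ t, ∫⁻ x, ‖ρ.normed volume t‖ₑ * ‖h (x - t)‖ₑ := by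
        refine lintegral_lintegral_swap ?_
        refine AEMeasurable.mul (M := ℝ≥0∞) ?_ ?_
        · exact (ρ.continuous_normed.measurable.comp measurable_snd).enorm.aemeasurable
        · exact (hh.comp_quasiMeasurePreserving
            (quasiMeasurePreserving_sub_of_right_invariant volume volume)).enorm
    _ = ∫⁻ t, ‖ρ.normed volume t‖ₑ * ∫⁻ x, ‖h x‖ₑ := by
        refine lintegral_congr fun t => ?_
        rw [lintegral_const_mul' _ _ enorm_ne_top, lintegral_sub_right_eq_self fun x => ‖h x‖ₑ]
    _ = ∫⁻ x, ‖h x‖ₑ := by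
        rw [lintegral_mul_const'' _ ρ.continuous_normed.measurable.enorm.aemeasurable, hρ, one_mul]

/-- Approximate the cut-off function in `L¹` by a continuous `h` with compact support. Convolution
contracts the error and converges uniformly on `h`. -/
lemma tendsto_lintegral_mollify_sub [CompleteSpace F] (hK : IsCompact K) (hf : IntegrableOn f K) :
    Tendsto (fun n => ∫⁻ y in K, ‖mollify (bumpSeq G n) K f y - f y‖ₑ) atTop (𝓝 0) := by
  have hi := (integrable_indicator_iff hK.measurableSet).2 hf
  rw [ENNReal.tendsto_nhds_zero]
  intro ε hε
  -- Error budget: `η` for the approximation by `h`, `η` for its convolution, and `η * volume K` for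
  -- the uniform error.
  obtain ⟨η, hη, hηε⟩ : ∃ η : ℝ≥0, 0 < η ∧ (η : ℝ≥0∞) * (2 + volume K) ≤ ε := by
    have hV : (2 + volume K) ≠ ⊤ := by simp [hK.measure_lt_top.ne]
    have h2 : (2 + volume K) ≠ 0 := by simp
    have h0 : 0 < ε / (2 + volume K) := ENNReal.div_pos hε.ne' hV
    obtain ⟨η, h, h'⟩ := ENNReal.lt_iff_exists_nnreal_btwn.1 h0
    exact ⟨η, by simpa using h, (ENNReal.le_div_iff_mul_le (.inl h2) (.inl hV)).1 h'.le⟩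
  obtain ⟨h, hcs, hfh, hc, hint⟩ := hi.exists_hasCompactSupport_lintegral_sub_le
    (ε := η) (by simpa using hη.ne')
  obtain ⟨δ, hδ, hδ'⟩ := Metric.uniformContinuous_iff.1
    (hcs.uniformContinuous_of_continuous hc) η (by simpa using hη)
  filter_upwards [tendsto_rOut_bumpSeq (G := G) |>.eventually_lt_const hδ] with n hn
  set ρ := bumpSeq G n
  have key : ∀ y ∈ K, ‖mollify ρ K f y - f y‖ₑ ≤
      ‖(ρ.normed volume ⋆[ContinuousLinearMap.lsmul ℝ ℝ, volume] (K.indicator f - h)) y‖ₑ + η +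
        ‖(K.indicator f - h) y‖ₑ := by
    intro y hy
    have e1 : mollify ρ K f y =
        (ρ.normed volume ⋆[ContinuousLinearMap.lsmul ℝ ℝ, volume] (K.indicator f - h)) y +
          (ρ.normed volume ⋆[ContinuousLinearMap.lsmul ℝ ℝ, volume] h) y := by
      have c1 : ConvolutionExistsAt (ρ.normed volume) (K.indicator f - h) y
          (ContinuousLinearMap.lsmul ℝ ℝ) volume :=
        ρ.hasCompactSupport_normed.convolutionExists_left _ ρ.continuous_normed
          (hi.sub hint).locallyIntegrable y
      have c2 : ConvolutionExistsAt (ρ.normed volume) h y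
          (ContinuousLinearMap.lsmul ℝ ℝ) volume :=
        ρ.hasCompactSupport_normed.convolutionExists_left _ ρ.continuous_normed
          hint.locallyIntegrable y
      rw [← c1.distrib_add c2, sub_add_cancel]
      rfl
    have e2 : dist ((ρ.normed volume ⋆[ContinuousLinearMap.lsmul ℝ ℝ, volume] h) y) (h y) ≤ η :=
      ρ.dist_normed_convolution_le hc.aestronglyMeasurable fun z hz =>
        (hδ' (lt_trans hz hn)).le
    have e3 : ‖(ρ.normed volume ⋆[ContinuousLinearMap.lsmul ℝ ℝ, volume] h) y - h y‖ₑ ≤ η := by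
      rw [← ofReal_norm, ← dist_eq_norm]
      exact (ENNReal.ofReal_le_ofReal e2).trans (by simp)
    have e4 : mollify ρ K f y - f y =
        (ρ.normed volume ⋆[ContinuousLinearMap.lsmul ℝ ℝ, volume] (K.indicator f - h)) y +
        ((ρ.normed volume ⋆[ContinuousLinearMap.lsmul ℝ ℝ, volume] h) y - h y) -
        (K.indicator f - h) y := by
      rw [e1]; simp only [Pi.sub_apply, indicator_of_mem hy]; abel
    rw [e4]
    exact (enorm_sub_le).trans (by gcongr; exact (enorm_add_le _ _).trans (by gcongr))
  have hm : AEStronglyMeasurable (K.indicator f - h) volume := (hi.sub hint).aestronglyMeasurable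
  calc ∫⁻ y in K, ‖mollify ρ K f y - f y‖ₑ
      ≤ ∫⁻ y in K,
          (‖(ρ.normed volume ⋆[ContinuousLinearMap.lsmul ℝ ℝ, volume] (K.indicator f - h)) y‖ₑ + η +
          ‖(K.indicator f - h) y‖ₑ) := setLIntegral_mono_ae' hK.measurableSet (.of_forall key)
    _ = (∫⁻ y in K,
          ‖(ρ.normed volume ⋆[ContinuousLinearMap.lsmul ℝ ℝ, volume] (K.indicator f - h)) y‖ₑ) +
          η * volume K + ∫⁻ y in K, ‖(K.indicator f - h) y‖ₑ := by
        rw [lintegral_add_right' _ hm.restrict.enorm, lintegral_add_right _ measurable_const,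
          setLIntegral_const]
    _ ≤ η + η * volume K + η := by
        gcongr
        · exact (setLIntegral_le_lintegral _ _).trans
            ((lintegral_enorm_convolution_normed_le hm).trans hfh)
        · exact (setLIntegral_le_lintegral _ _).trans hfh
    _ ≤ ε := le_trans (le_of_eq (by ring)) hηε

/-- The translated reflected bump `y ↦ ρ(x - y)` is an admissible test function once its ball lies
in `K`. Reflection produces a minus sign that cancels the one in the weak derivative, and the
cut-off is invisible on that ball. -/
lemma IsWeakDirDeriv.fderiv_mollify (h : IsWeakDirDeriv W v f g) (hK : IsCompact K) (hKW : K ⊆ W)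
    (hx : closedBall x ρ.rOut ⊆ K) :
    fderiv ℝ (mollify ρ K f) x v = mollify ρ K g x := by
  have hi := (integrable_indicator_iff hK.measurableSet).2 (h.left.integrableOn_compact_subset hKW hK)
  have hρ : ContDiff ℝ ∞ (ρ.normed (volume : Measure G)) := ρ.contDiff_normed
  have h1 := ρ.hasCompactSupport_normed.hasFDerivAt_convolution_left
    (ContinuousLinearMap.lsmul ℝ ℝ) (hρ.of_le (by simp)) hi.locallyIntegrable x (μ := volume)
  set ψ : G → ℝ := fun y => ρ.normed volume (x - y) with hψ
  have hψd : ContDiff ℝ ∞ ψ := hρ.comp (contDiff_const.sub contDiff_id)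
  have hsub : tsupport ψ ⊆ closedBall x ρ.rOut := by
    refine closure_minimal (fun y hy => ?_) isClosed_closedBall
    have : x - y ∈ Function.support (ρ.normed (volume : Measure G)) := hy
    rw [ρ.support_normed_eq] at this
    have := mem_ball_zero_iff.1 this
    rw [mem_closedBall, dist_comm, dist_eq_norm]
    exact this.le
  have hψc : HasCompactSupport ψ :=
    HasCompactSupport.of_support_subset_isCompact (isCompact_closedBall x ρ.rOut)
      (subset_closure.trans hsub)
  have hψ' : ∀ y, fderiv ℝ ψ y v = -fderiv ℝ (ρ.normed volume) (x - y) v := by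
    intro y
    have : HasFDerivAt ψ ((fderiv ℝ (ρ.normed volume) (x - y)).comp
        (-ContinuousLinearMap.id ℝ G)) y :=
      ((hρ.differentiable (by simp)) (x - y)).hasFDerivAt.comp y
        ((hasFDerivAt_id y).const_sub x)
    rw [this.fderiv]; simp
  have hz : ∀ y ∉ K, ψ y = 0 ∧ fderiv ℝ ψ y v = 0 := by
    intro y hy
    have : y ∉ tsupport ψ := fun h' => hy (hx (hsub h'))
    exact ⟨image_eq_zero_of_notMem_tsupport this, by
      rw [fderiv_of_notMem_tsupport ℝ this]; rfl⟩
  have key := h.integral_eq ψ hψd hψc (hsub.trans (hx.trans hKW))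
  have e1 : fderiv ℝ (mollify ρ K f) x v = ∫ t, fderiv ℝ (ρ.normed volume) t v •
      K.indicator f (x - t) := by
    have hex := (ρ.hasCompactSupport_normed.fderiv ℝ).convolutionExists_left
      ((ContinuousLinearMap.lsmul ℝ ℝ).precompL G) (hρ.continuous_fderiv (by simp))
      hi.locallyIntegrable x (μ := volume)
    rw [show fderiv ℝ (mollify ρ K f) x = _ from h1.fderiv, convolution_def,
      ContinuousLinearMap.integral_apply hex]
    simp
  have e2 : ∫ t, fderiv ℝ (ρ.normed volume) t v • K.indicator f (x - t) =
      ∫ t, fderiv ℝ (ρ.normed volume) (x - t) v • K.indicator f t :=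
    convolution_lsmul_swap (f := fun t => fderiv ℝ (ρ.normed volume) t v) (μ := volume)
  have e3 : mollify ρ K g x = ∫ t, ψ t • K.indicator g t := convolution_lsmul_swap
  have e4 : ∫ t, fderiv ℝ (ρ.normed volume) (x - t) v • K.indicator f t =
      -∫ t in W, fderiv ℝ ψ t v • f t := by
    rw [setIntegral_eq_integral_of_forall_compl_eq_zero, ← integral_neg]
    · refine integral_congr_ae (.of_forall fun t => ?_)
      by_cases ht : t ∈ K
      · simp [ht, hψ']
      · simp [ht, (hz t ht).2]
    · intro t ht
      simp [(hz t fun h' => ht (hKW h')).2]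
  rw [e1, e2, e3, e4, key, neg_neg, setIntegral_eq_integral_of_forall_compl_eq_zero]
  · refine integral_congr_ae (.of_forall fun t => ?_)
    by_cases ht : t ∈ K
    · simp [ht]
    · simp [ht, (hz t ht).1]
  · intro t ht
    simp [(hz t fun h' => ht (hKW h')).1]

end Mollification

/-! ### Smooth approximation near compact sets. -/

section Approximation

lemma exists_compact_nhd_bumpSeq {G : Type*} [NormedAddCommGroup G] [NormedSpace ℝ G]
    [FiniteDimensional ℝ G] {K W : Set G} (hW : IsOpen W) (hK : IsCompact K) (hKW : K ⊆ W) :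
    ∃ K', IsCompact K' ∧ K ⊆ K' ∧ K' ⊆ W ∧
      ∃ N, ∀ n, ∀ x ∈ K, closedBall x (bumpSeq G (n + N)).rOut ⊆ K' := by
  obtain ⟨δ, hδ, hδW⟩ := hK.exists_cthickening_subset_open hW hKW
  obtain ⟨N, hN⟩ := eventually_atTop.1 ((tendsto_rOut_bumpSeq (G := G)).eventually_le_const hδ)
  refine ⟨cthickening δ K, hK.cthickening, self_subset_cthickening K, hδW, N, fun n x hx => ?_⟩
  exact (closedBall_subset_closedBall (hN _ (Nat.le_add_left N n))).trans
    (closedBall_subset_cthickening hx δ)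

variable {G : Type*} [NormedAddCommGroup G] [NormedSpace ℝ G] [FiniteDimensional ℝ G]
  [MeasureSpace G] [BorelSpace G] [(volume : Measure G).IsAddHaarMeasure]
variable {F : Type*} [NormedAddCommGroup F] [NormedSpace ℝ F]
variable {K W : Set G} {f g : G → F} {v : G}

/-- Uniform bounds with almost everywhere convergence: exactly what dominated convergence needs, in
place of `L^∞` convergence, which fails in general. -/
lemma IsWeakDirDeriv.exists_smooth_approx_of_bounded [CompleteSpace F]
    (h : IsWeakDirDeriv W v f g) (hW : IsOpen W) (hK : IsCompact K) (hKW : K ⊆ W) {B : ℝ}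
    (hB : 0 ≤ B) (hf : ∀ᵐ x ∂volume.restrict W, ‖f x‖ ≤ B)
    (hg : ∀ᵐ x ∂volume.restrict W, ‖g x‖ ≤ B) :
    ∃ s : ℕ → G → F, (∀ n, ContDiff ℝ ∞ (s n)) ∧ (∀ n x, ‖s n x‖ ≤ B) ∧
      (∀ n, ∀ x ∈ K, ‖fderiv ℝ (s n) x v‖ ≤ B) ∧
      (∀ᵐ x ∂volume.restrict K, Tendsto (fun n => s n x) atTop (𝓝 (f x))) ∧
      (∀ᵐ x ∂volume.restrict K, Tendsto (fun n => fderiv ℝ (s n) x v) atTop (𝓝 (g x))) := by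
  obtain ⟨K', hK', hKK', hK'W, N, hN⟩ := exists_compact_nhd_bumpSeq hW hK hKW
  have hm := hK'.measurableSet
  have hfi := h.left.integrableOn_compact_subset hK'W hK'
  have hgi := h.right.integrableOn_compact_subset hK'W hK'
  have hd : ∀ n, ∀ x ∈ K, fderiv ℝ (mollify (bumpSeq G (n + N)) K' f) x v =
      mollify (bumpSeq G (n + N)) K' g x := fun n x hx => h.fderiv_mollify hK' hK'W (hN n x hx)
  refine ⟨fun n => mollify (bumpSeq G (n + N)) K' f, fun n => contDiff_mollify hm hfi,
    fun n x => norm_mollify_le hB hm (ae_restrict_of_ae_restrict_of_subset hK'W hf),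
    fun n x hx => ?_, ?_, ?_⟩
  · rw [hd n x hx]
    exact norm_mollify_le hB hm (ae_restrict_of_ae_restrict_of_subset hK'W hg)
  · filter_upwards [ae_restrict_of_ae_restrict_of_subset hKK' (ae_tendsto_mollify hm hfi)] with x hx
    exact (tendsto_add_atTop_iff_nat N).2 hx
  · filter_upwards [ae_restrict_of_ae_restrict_of_subset hKK' (ae_tendsto_mollify hm hgi),
      ae_restrict_mem hK.measurableSet] with x hx hxK
    simp_rw [hd _ x hxK]
    exact (tendsto_add_atTop_iff_nat N).2 hx

/-- The mollifications do not depend on the direction, so one sequence serves all `e j`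
simultaneously. -/
lemma exists_smooth_approx_lintegral [CompleteSpace F] {ι : Type*} {e : ι → G} {g : ι → G → F}
    (hfW : LocallyIntegrableOn f W) (h : ∀ j, IsWeakDirDeriv W (e j) f (g j)) (hW : IsOpen W)
    (hK : IsCompact K) (hKW : K ⊆ W) :
    ∃ s : ℕ → G → F, (∀ n, ContDiff ℝ ∞ (s n)) ∧
      Tendsto (fun n => ∫⁻ x in K, ‖s n x - f x‖ₑ) atTop (𝓝 0) ∧
      ∀ j, Tendsto (fun n => ∫⁻ x in K, ‖fderiv ℝ (s n) x (e j) - g j x‖ₑ) atTop (𝓝 0) := by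
  obtain ⟨K', hK', hKK', hK'W, N, hN⟩ := exists_compact_nhd_bumpSeq hW hK hKW
  have hm := hK'.measurableSet
  have hfi := hfW.integrableOn_compact_subset hK'W hK'
  have hshift : ∀ {w : G → F}, IntegrableOn w K' →
      Tendsto (fun n => ∫⁻ x in K, ‖mollify (bumpSeq G (n + N)) K' w x - w x‖ₑ) atTop (𝓝 0) :=
    fun hw => tendsto_of_tendsto_of_tendsto_of_le_of_le tendsto_const_nhds
      ((tendsto_add_atTop_iff_nat N).2 (tendsto_lintegral_mollify_sub hK' hw))
      (fun _ => zero_le) (fun _ => lintegral_mono_set hKK')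
  refine ⟨fun n => mollify (bumpSeq G (n + N)) K' f, fun n => contDiff_mollify hm hfi,
    hshift hfi, fun j => ?_⟩
  refine (hshift ((h j).right.integrableOn_compact_subset hK'W hK')).congr fun n => ?_
  refine setLIntegral_congr_fun hK.measurableSet fun x hx => ?_
  simp only [(h j).fderiv_mollify hK' hK'W (hN n x hx)]

end Approximation

/-! ### Product rule, and chain rule with a smooth outer function. -/

section Calculus

lemma setIntegral_eq_setIntegral_of_vanishing {G F : Type*} [MeasureSpace G]
    [NormedAddCommGroup F] [NormedSpace ℝ F] {K W : Set G} {f : G → F}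
    (hW : MeasurableSet W) (hKW : K ⊆ W) (h : ∀ z ∉ K, f z = 0) :
    ∫ z in W, f z = ∫ z in K, f z :=
  setIntegral_eq_of_subset_of_forall_sdiff_eq_zero hW hKW fun z hz => h z hz.2

lemma fderiv_apply_eq_zero_of_notMem_tsupport {G : Type*} [NormedAddCommGroup G] [NormedSpace ℝ G]
    {φ : G → ℝ} {v z : G} (hz : z ∉ tsupport φ) :
    fderiv ℝ φ z v = 0 := by
  rw [fderiv_of_notMem_tsupport ℝ hz]; rfl

lemma HasCompactSupport.exists_bound_self_and_fderiv {G : Type*} [NormedAddCommGroup G] [NormedSpace ℝ G]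
    {φ : G → ℝ} (hφ : ContDiff ℝ ∞ φ) (hc : HasCompactSupport φ) (v : G) :
    ∃ C, 0 ≤ C ∧ (∀ z, ‖φ z‖ ≤ C) ∧ ∀ z, ‖fderiv ℝ φ z v‖ ≤ C := by
  obtain ⟨C₁, h₁⟩ := hc.exists_bound_of_continuous hφ.continuous
  obtain ⟨C₂, h₂⟩ := (hc.fderiv_apply ℝ v).exists_bound_of_continuous
    ((hφ.continuous_fderiv (by simp)).clm_apply continuous_const)
  exact ⟨max C₁ C₂, le_max_of_le_left ((norm_nonneg _).trans (h₁ 0)),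
    fun z => (h₁ z).trans (le_max_left _ _), fun z => (h₂ z).trans (le_max_right _ _)⟩

lemma LocallyIntegrableOn.mul_ae_bounded {G : Type*} [NormedAddCommGroup G] [NormedSpace ℝ G]
    [FiniteDimensional ℝ G] [MeasureSpace G] {W : Set G} {f h : G → ℝ} {C : ℝ} (hW : IsOpen W)
    (hf : LocallyIntegrableOn f W) (hm : AEStronglyMeasurable h (volume.restrict W))
    (hh : ∀ᵐ x ∂volume.restrict W, ‖h x‖ ≤ C) : LocallyIntegrableOn (fun z => f z * h z) W := by
  rw [locallyIntegrableOn_iff hW.isLocallyClosed] at hf ⊢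
  exact fun k hkW hk => (hf k hkW hk).mul_bdd (hm.mono_measure (Measure.restrict_mono hkW le_rfl))
    (ae_restrict_of_ae_restrict_of_subset hkW hh)

variable {G : Type*} [NormedAddCommGroup G] [NormedSpace ℝ G] [FiniteDimensional ℝ G]
  [MeasureSpace G] [BorelSpace G] [(volume : Measure G).IsAddHaarMeasure]
variable {H : Type*} [NormedAddCommGroup H] [NormedSpace ℝ H] [FiniteDimensional ℝ H]
variable {W : Set G} {v : G}

lemma locallyIntegrableOn_of_ae_bounded {F : Type*} [NormedAddCommGroup F] {f : G → F} {C : ℝ}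
    (hm : AEStronglyMeasurable f (volume.restrict W))
    (hf : ∀ᵐ x ∂volume.restrict W, ‖f x‖ ≤ C) : LocallyIntegrableOn f W :=
  locallyIntegrableOn_of_locallyIntegrable_restrict
    ((memLp_top_of_bound hm C hf).locallyIntegrable le_top)

/-- The product rule for a weakly differentiable function and a bounded one with bounded weak
derivative. -/
lemma IsWeakDirDeriv.mul {f f' h h' : G → ℝ} (hW : IsOpen W) (hf : IsWeakDirDeriv W v f f')
    (hh : IsWeakDirDeriv W v h h') {B : ℝ} (hB : ∀ᵐ x ∂volume.restrict W, ‖h x‖ ≤ B)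
    (hB' : ∀ᵐ x ∂volume.restrict W, ‖h' x‖ ≤ B) :
    IsWeakDirDeriv W v (fun z => f z * h z) (fun z => f' z * h z + f z * h' z) := by
  wlog hB0 : 0 ≤ B
  · exact this hW hf hh (B := max B 0) (hB.mono fun x hx => hx.trans (le_max_left _ _))
      (hB'.mono fun x hx => hx.trans (le_max_left _ _)) (le_max_right _ _)
  have hhm := hh.left.aestronglyMeasurable
  have hhm' := hh.right.aestronglyMeasurable
  have i1 := LocallyIntegrableOn.mul_ae_bounded hW hf.left hhm hB
  have i2 := LocallyIntegrableOn.mul_ae_bounded hW hf.right hhm hB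
  have i3 := LocallyIntegrableOn.mul_ae_bounded hW hf.left hhm' hB'
  refine ⟨i1, i2.add i3, fun φ hφ hc hs => ?_⟩
  set K := tsupport φ with hKdef
  have hK : IsCompact K := hc
  -- Only the bounded factor `h` is mollified. Then `φ * s n` is a test function for `f`, and every
  -- integrand is dominated by a multiple of `‖f‖` or `‖f'‖`.
  obtain ⟨s, sd, sb, sb', sl, sl'⟩ := hh.exists_smooth_approx_of_bounded hW hK hs hB0 hB hB'
  obtain ⟨C, hC0, hC, hC'⟩ := HasCompactSupport.exists_bound_self_and_fderiv hφ hc v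
  have z0 : ∀ z ∉ K, φ z = 0 := fun z hz => image_eq_zero_of_notMem_tsupport hz
  have z1 : ∀ z ∉ K, fderiv ℝ φ z v = 0 := fun z hz => fderiv_apply_eq_zero_of_notMem_tsupport hz
  have hfK := hf.left.integrableOn_compact_subset hs hK
  have hfK' := hf.right.integrableOn_compact_subset hs hK
  have dφ : Continuous fun z => fderiv ℝ φ z v :=
    (hφ.continuous_fderiv (by simp)).clm_apply continuous_const
  have ds : ∀ n, Continuous fun z => fderiv ℝ (s n) z v := fun n =>
    ((sd n).continuous_fderiv (by simp)).clm_apply continuous_const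
  have step : ∀ n, ∫ z in K, (fderiv ℝ φ z v * s n z + φ z * fderiv ℝ (s n) z v) * f z =
      -∫ z in K, (φ z * s n z) * f' z := by
    intro n
    have hsub : tsupport (fun z => φ z * s n z) ⊆ K := tsupport_mul_subset_left
    have key := hf.integral_eq (fun z => φ z * s n z) (hφ.mul (sd n)) hc.mul_right (hsub.trans hs)
    have hd : ∀ z, fderiv ℝ (fun z => φ z * s n z) z v =
        fderiv ℝ φ z v * s n z + φ z * fderiv ℝ (s n) z v := by
      intro z
      rw [fderiv_fun_mul (hφ.differentiable (by simp) z) ((sd n).differentiable (by simp) z)]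
      simp; ring
    simp only [hd, smul_eq_mul] at key
    rwa [setIntegral_eq_setIntegral_of_vanishing hW.measurableSet hs,
      setIntegral_eq_setIntegral_of_vanishing hW.measurableSet hs] at key
    · intro z hz; simp [z0 z hz]
    · intro z hz; simp [z0 z hz, z1 z hz]
  have lim1 : Tendsto (fun n => ∫ z in K, (fderiv ℝ φ z v * s n z + φ z * fderiv ℝ (s n) z v) * f z)
      atTop (𝓝 (∫ z in K, (fderiv ℝ φ z v * h z + φ z * h' z) * f z)) := by
    refine tendsto_integral_of_dominated_convergence (fun z => (C * B + C * B) * ‖f z‖) ?_ ?_ ?_ ?_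
    · intro n
      exact (((dφ.mul (sd n).continuous).add
        (hφ.continuous.mul (ds n))).aestronglyMeasurable).mul hfK.aestronglyMeasurable
    · exact hfK.norm.const_mul _
    · intro n
      filter_upwards [ae_restrict_mem hK.measurableSet] with z hz
      rw [norm_mul]
      gcongr
      refine (norm_add_le _ _).trans ?_
      rw [norm_mul, norm_mul]
      gcongr
      · exact hC' z
      · exact sb n z
      · exact hC z
      · exact sb' n z hz
    · filter_upwards [sl, sl'] with z h1 h2
      exact ((h1.const_mul _).add (h2.const_mul _)).mul_const _
  have lim2 : Tendsto (fun n => -∫ z in K, (φ z * s n z) * f' z)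
      atTop (𝓝 (-∫ z in K, (φ z * h z) * f' z)) := by
    refine (tendsto_integral_of_dominated_convergence (fun z => (C * B) * ‖f' z‖) ?_ ?_ ?_ ?_).neg
    · intro n
      exact (hφ.continuous.mul (sd n).continuous).aestronglyMeasurable.mul hfK'.aestronglyMeasurable
    · exact hfK'.norm.const_mul _
    · intro n
      refine .of_forall fun z => ?_
      rw [norm_mul, norm_mul]
      gcongr
      · exact hC z
      · exact sb n z
    · filter_upwards [sl] with z h1
      exact (h1.const_mul _).mul_const _
  simp only [step] at lim1
  have fin := tendsto_nhds_unique lim1 lim2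
  have k1 := i1.integrableOn_compact_subset hs hK
  have k2 := i2.integrableOn_compact_subset hs hK
  have k3 := i3.integrableOn_compact_subset hs hK
  have b1 : IntegrableOn (fun z => fderiv ℝ φ z v * (f z * h z)) K :=
    k1.bdd_mul dφ.aestronglyMeasurable (.of_forall hC')
  have b2 : IntegrableOn (fun z => φ z * (f' z * h z)) K :=
    k2.bdd_mul hφ.continuous.aestronglyMeasurable (.of_forall hC)
  have b3 : IntegrableOn (fun z => φ z * (f z * h' z)) K :=
    k3.bdd_mul hφ.continuous.aestronglyMeasurable (.of_forall hC)
  simp only [smul_eq_mul]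
  rw [setIntegral_eq_setIntegral_of_vanishing hW.measurableSet hs fun z hz => by simp [z1 z hz],
    setIntegral_eq_setIntegral_of_vanishing hW.measurableSet hs fun z hz => by simp [z0 z hz]]
  simp only [mul_add]
  rw [integral_add b2 b3]
  have e1 : ∫ z in K, (fderiv ℝ φ z v * h z + φ z * h' z) * f z =
      (∫ z in K, fderiv ℝ φ z v * (f z * h z)) + ∫ z in K, φ z * (f z * h' z) := by
    rw [← integral_add b1 b3]
    congr 1; ext z; ring
  have e2 : ∫ z in K, (φ z * h z) * f' z = ∫ z in K, φ z * (f' z * h z) := by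
    congr 1; ext z; ring
  rw [e1, e2] at fin
  linarith

/-- The chain rule for a smooth outer function and a bounded inner one with bounded weak
derivative. -/
lemma IsWeakDirDeriv.contDiff_comp {Φ g : G → H} {u : H → ℝ} (hW : IsOpen W)
    (h : IsWeakDirDeriv W v Φ g) (hu : ContDiff ℝ ∞ u) {B : ℝ}
    (hB : ∀ᵐ x ∂volume.restrict W, ‖Φ x‖ ≤ B) (hB' : ∀ᵐ x ∂volume.restrict W, ‖g x‖ ≤ B) :
    IsWeakDirDeriv W v (fun z => u (Φ z)) (fun z => fderiv ℝ u (Φ z) (g z)) := by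
  wlog hB0 : 0 ≤ B
  · exact this hW h hu (B := max B 0) (hB.mono fun x hx => hx.trans (le_max_left _ _))
      (hB'.mono fun x hx => hx.trans (le_max_left _ _)) (le_max_right _ _)
  have hΦm := h.left.aestronglyMeasurable
  have hgm := h.right.aestronglyMeasurable
  have du : Continuous (fderiv ℝ u) := hu.continuous_fderiv (by simp)
  have : ProperSpace H := FiniteDimensional.proper ℝ H
  -- Mollification keeps the values in the ball of radius `B`, so bounds for `u` and its derivative
  -- on this ball serve `Φ` and all its approximants.
  obtain ⟨A, hA⟩ := (isCompact_closedBall (0 : H) B).exists_bound_of_continuousOn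
    hu.continuous.continuousOn
  obtain ⟨A', hA'⟩ := (isCompact_closedBall (0 : H) B).exists_bound_of_continuousOn
    du.continuousOn
  simp only [mem_closedBall_zero_iff] at hA hA'
  have hA0 : 0 ≤ A := (norm_nonneg _).trans (hA 0 (by simpa using hB0))
  have hA0' : 0 ≤ A' := (norm_nonneg _).trans (hA' 0 (by simpa using hB0))
  have i1 : LocallyIntegrableOn (fun z => u (Φ z)) W :=
    locallyIntegrableOn_of_ae_bounded (hu.continuous.comp_aestronglyMeasurable hΦm)
      (hB.mono fun x hx => hA _ hx)
  have i2 : LocallyIntegrableOn (fun z => fderiv ℝ u (Φ z) (g z)) W := by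
    refine locallyIntegrableOn_of_ae_bounded (C := A' * B) ?_ ?_
    · exact ContinuousLinearMap.aestronglyMeasurable_comp₂
        (ContinuousLinearMap.id ℝ (H →L[ℝ] ℝ)) (du.comp_aestronglyMeasurable hΦm) hgm
    · filter_upwards [hB, hB'] with z h1 h2
      exact (ContinuousLinearMap.le_opNorm _ _).trans
        (mul_le_mul (hA' _ h1) h2 (norm_nonneg _) hA0')
  refine ⟨i1, i2, fun φ hφ hc hs => ?_⟩
  set K := tsupport φ with hKdef
  have hK : IsCompact K := hc
  obtain ⟨s, sd, sb, sb', sl, sl'⟩ := h.exists_smooth_approx_of_bounded hW hK hs hB0 hB hB'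
  obtain ⟨C, hC0, hC, hC'⟩ := HasCompactSupport.exists_bound_self_and_fderiv hφ hc v
  have z0 : ∀ z ∉ K, φ z = 0 := fun z hz => image_eq_zero_of_notMem_tsupport hz
  have z1 : ∀ z ∉ K, fderiv ℝ φ z v = 0 := fun z hz => fderiv_apply_eq_zero_of_notMem_tsupport hz
  have dφ : Continuous fun z => fderiv ℝ φ z v :=
    (hφ.continuous_fderiv (by simp)).clm_apply continuous_const
  have ds : ∀ n, Continuous fun z => fderiv ℝ (s n) z v := fun n =>
    ((sd n).continuous_fderiv (by simp)).clm_apply continuous_const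
  have dus : ∀ n, Continuous fun z => fderiv ℝ u (s n z) (fderiv ℝ (s n) z v) := fun n =>
    (du.comp (sd n).continuous).clm_apply (ds n)
  have hKfin : IsFiniteMeasure ((volume : Measure G).restrict K) := ⟨by simpa using hK.measure_lt_top⟩
  have step : ∀ n, ∫ z in K, fderiv ℝ φ z v * u (s n z) =
      -∫ z in K, φ z * fderiv ℝ u (s n z) (fderiv ℝ (s n) z v) := by
    intro n
    have hd : ∀ z, fderiv ℝ (fun z => u (s n z)) z v =
        fderiv ℝ u (s n z) (fderiv ℝ (s n) z v) := by
      intro z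
      have := ((hu.differentiable (by simp) (s n z)).hasFDerivAt.comp z
        ((sd n).differentiable (by simp) z).hasFDerivAt).fderiv
      rw [show (fun z => u (s n z)) = u ∘ s n from rfl, this]; rfl
    -- `u ∘ s n` is smooth on the whole space and `φ` has compact support, so classical integration
    -- by parts applies globally.
    have key := integral_mul_fderiv_eq_neg_fderiv_mul_of_integrable (μ := volume) (v := v)
      (f := φ) (g := fun z => u (s n z)) ?_ ?_ ?_
      (fun z _ => hφ.differentiable (by simp) z)
      (fun z _ => (hu.comp (sd n)).differentiable (by simp) z)
    · simp only [hd] at key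
      rw [← setIntegral_univ, setIntegral_eq_setIntegral_of_vanishing .univ (subset_univ K),
        ← setIntegral_univ (f := fun z => fderiv ℝ φ z v * u (s n z)),
        setIntegral_eq_setIntegral_of_vanishing .univ (subset_univ K)] at key
      · rw [key, neg_neg]
      · intro z hz; simp [z1 z hz]
      · intro z hz; simp [z0 z hz]
    · exact (dφ.mul (hu.continuous.comp (sd n).continuous)).integrable_of_hasCompactSupport
        (hc.fderiv_apply ℝ v).mul_right
    · simp only [hd]
      exact (hφ.continuous.mul (dus n)).integrable_of_hasCompactSupport hc.mul_right
    · exact (hφ.continuous.mul (hu.continuous.comp (sd n).continuous)).integrable_of_hasCompactSupport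
        hc.mul_right
  have lim1 : Tendsto (fun n => ∫ z in K, fderiv ℝ φ z v * u (s n z))
      atTop (𝓝 (∫ z in K, fderiv ℝ φ z v * u (Φ z))) := by
    refine tendsto_integral_of_dominated_convergence (fun z => C * A) ?_ (integrable_const _) ?_ ?_
    · exact fun n => (dφ.mul (hu.continuous.comp (sd n).continuous)).aestronglyMeasurable
    · refine fun n => .of_forall fun z => ?_
      rw [norm_mul]
      exact mul_le_mul (hC' z) (hA _ (sb n z)) (norm_nonneg _) hC0
    · filter_upwards [sl] with z h1
      exact ((hu.continuous.tendsto _).comp h1).const_mul _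
  have lim2 : Tendsto (fun n => -∫ z in K, φ z * fderiv ℝ u (s n z) (fderiv ℝ (s n) z v))
      atTop (𝓝 (-∫ z in K, φ z * fderiv ℝ u (Φ z) (g z))) := by
    refine (tendsto_integral_of_dominated_convergence (fun z => C * (A' * B)) ?_
      (integrable_const _) ?_ ?_).neg
    · exact fun n => (hφ.continuous.mul (dus n)).aestronglyMeasurable
    · intro n
      filter_upwards [ae_restrict_mem hK.measurableSet] with z hz
      rw [norm_mul]
      refine mul_le_mul (hC z) ?_ (norm_nonneg _) hC0
      exact (ContinuousLinearMap.le_opNorm _ _).trans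
        (mul_le_mul (hA' _ (sb n z)) (sb' n z hz) (norm_nonneg _) hA0')
    · filter_upwards [sl, sl'] with z h1 h2
      have h3 : Tendsto (fun n => fderiv ℝ u (s n z)) atTop (𝓝 (fderiv ℝ u (Φ z))) :=
        (du.tendsto _).comp h1
      have h4 := (isBoundedBilinearMap_apply (𝕜 := ℝ) (E := H) (F := ℝ)).continuous.tendsto
        (fderiv ℝ u (Φ z), g z)
      exact (h4.comp (h3.prodMk_nhds h2)).const_mul _
  simp only [step] at lim1
  simp only [smul_eq_mul]
  rw [setIntegral_eq_setIntegral_of_vanishing hW.measurableSet hs fun z hz => by simp [z1 z hz],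
    setIntegral_eq_setIntegral_of_vanishing hW.measurableSet hs fun z hz => by simp [z0 z hz]]
  exact tendsto_nhds_unique lim1 lim2

end Calculus

/-! ### Pullback maps and the chain rule with a Sobolev outer function. -/

section Composition

set_option linter.unusedSectionVars false

variable {G : Type*} [NormedAddCommGroup G] [NormedSpace ℝ G] [FiniteDimensional ℝ G]
  [MeasureSpace G] [BorelSpace G] [(volume : Measure G).IsAddHaarMeasure]
variable {H : Type*} [NormedAddCommGroup H] [NormedSpace ℝ H] [FiniteDimensional ℝ H]
  [MeasureSpace H] [BorelSpace H] [(volume : Measure H).IsAddHaarMeasure]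
variable {W K : Set G} {U : Set H} {Φ : G → H} {c : ℝ≥0}

/-- `Φ` maps `W` continuously to `U`, and the preimage of a set is at most `c` times as large
as the set. -/
structure IsPullbackMap (c : ℝ≥0) (W : Set G) (U : Set H) (Φ : G → H) : Prop where
  continuousOn : ContinuousOn Φ W
  mapsTo : MapsTo Φ W U
  map_le : (volume.restrict W).map Φ ≤ c • volume.restrict U

lemma IsPullbackMap.aemeasurable (h : IsPullbackMap c W U Φ) (hW : MeasurableSet W) :
    AEMeasurable Φ (volume.restrict W) := h.continuousOn.aemeasurable hW

/-- This makes composition well defined on almost-everywhere classes. -/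
lemma IsPullbackMap.absolutelyContinuous (h : IsPullbackMap c W U Φ) :
    (volume.restrict W).map Φ ≪ volume.restrict U :=
  (Measure.absolutelyContinuous_of_le h.map_le).trans
    (Measure.smul_absolutelyContinuous)

lemma IsPullbackMap.aestronglyMeasurable_comp {F : Type*} [NormedAddCommGroup F] {w : H → F}
    (h : IsPullbackMap c W U Φ) (hW : MeasurableSet W)
    (hw : AEStronglyMeasurable w (volume.restrict U)) :
    AEStronglyMeasurable (fun z => w (Φ z)) (volume.restrict W) :=
  (hw.mono_ac h.absolutelyContinuous).comp_aemeasurable (h.aemeasurable hW)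

lemma IsPullbackMap.eLpNorm_two_comp_le {F : Type*} [NormedAddCommGroup F] {w : H → F}
    (h : IsPullbackMap c W U Φ) (hW : MeasurableSet W)
    (hw : AEStronglyMeasurable w (volume.restrict U)) :
    eLpNorm (fun z => w (Φ z)) 2 (volume.restrict W) ≤
      (c ^ (1 / 2 : ℝ) : ℝ≥0) * eLpNorm w 2 (volume.restrict U) := by
  calc eLpNorm (fun z => w (Φ z)) 2 (volume.restrict W)
      = eLpNorm w 2 ((volume.restrict W).map Φ) :=
        (eLpNorm_map_measure (hw.mono_ac h.absolutelyContinuous) (h.aemeasurable hW)).symm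
    _ ≤ eLpNorm w 2 ((c : ℝ≥0∞) • volume.restrict U) := eLpNorm_mono_measure _ h.map_le
    _ = _ := by
        rw [eLpNorm_smul_measure_of_ne_top (by simp)]
        simp [ENNReal.coe_rpow_of_nonneg]

/-- Inserting the indicator of the compact image localizes the measure bound, so functions only
locally integrable on `U` can be composed. -/
lemma IsPullbackMap.lintegral_comp_le (h : IsPullbackMap c W U Φ) (hW : MeasurableSet W)
    (hK : IsCompact K) (hKW : K ⊆ W) {w : H → ℝ≥0∞} (hw : AEMeasurable w (volume.restrict U)) :
    ∫⁻ z in K, w (Φ z) ≤ c * ∫⁻ y in Φ '' K, w y := by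
  have hT : MeasurableSet (Φ '' K) :=
    (hK.image_of_continuousOn (h.continuousOn.mono hKW)).measurableSet
  have hTU : Φ '' K ⊆ U := image_subset_iff.2 fun z hz => h.mapsTo (hKW hz)
  calc ∫⁻ z in K, w (Φ z) = ∫⁻ z in K, (Φ '' K).indicator w (Φ z) :=
        setLIntegral_congr_fun hK.measurableSet fun z hz => by
          simp [indicator_of_mem (mem_image_of_mem Φ hz)]
    _ ≤ ∫⁻ z in W, (Φ '' K).indicator w (Φ z) := lintegral_mono_set hKW
    _ = ∫⁻ y, (Φ '' K).indicator w y ∂((volume.restrict W).map Φ) :=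
        (lintegral_map' ((hw.indicator hT).mono_ac h.absolutelyContinuous) (h.aemeasurable hW)).symm
    _ ≤ ∫⁻ y, (Φ '' K).indicator w y ∂(c • volume.restrict U) := lintegral_mono' h.map_le le_rfl
    _ = c * ∫⁻ y in Φ '' K, w y := by
        rw [lintegral_smul_measure, lintegral_indicator hT, Measure.restrict_restrict hT,
          inter_eq_left.2 hTU]
        rfl

lemma IsPullbackMap.integrableOn_comp (h : IsPullbackMap c W U Φ) (hW : MeasurableSet W)
    (hK : IsCompact K) (hKW : K ⊆ W) {w : H → ℝ} (hw : LocallyIntegrableOn w U) :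
    IntegrableOn (fun z => w (Φ z)) K := by
  have hT := hK.image_of_continuousOn (h.continuousOn.mono hKW)
  have hTU : Φ '' K ⊆ U := image_subset_iff.2 fun z hz => h.mapsTo (hKW hz)
  refine ⟨(h.aestronglyMeasurable_comp hW hw.aestronglyMeasurable).mono_measure
    (Measure.restrict_mono hKW le_rfl), ?_⟩
  refine (h.lintegral_comp_le hW hK hKW hw.aestronglyMeasurable.enorm).trans_lt ?_
  exact ENNReal.mul_lt_top ENNReal.coe_lt_top (hw.integrableOn_compact_subset hTU hT).2

/-- Integrals of compositions against a bounded weight pass to limits in `L¹`. -/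
lemma IsPullbackMap.tendsto_integral_mul_comp (h : IsPullbackMap c W U Φ) (hW : MeasurableSet W)
    (hK : IsCompact K) (hKW : K ⊆ W) {w : H → ℝ} (hw : LocallyIntegrableOn w U)
    {s : ℕ → H → ℝ} (hs : ∀ n, Continuous (s n))
    (hlim : Tendsto (fun n => ∫⁻ y in Φ '' K, ‖s n y - w y‖ₑ) atTop (𝓝 0))
    {m : G → ℝ} (hm : AEStronglyMeasurable m (volume.restrict K)) {C : ℝ≥0}
    (hC : ∀ᵐ z ∂volume.restrict K, ‖m z‖ ≤ C) :
    Tendsto (fun n => ∫ z in K, m z * s n (Φ z)) atTop (𝓝 (∫ z in K, m z * w (Φ z))) := by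
  refine tendsto_integral_of_L1 _ ?_ (.of_forall fun n => ?_) ?_
  · exact ((h.integrableOn_comp hW hK hKW hw).bdd_mul hm hC).aestronglyMeasurable
  · exact (h.integrableOn_comp hW hK hKW ((hs n).locallyIntegrable.locallyIntegrableOn U)).bdd_mul
      hm hC
  · have hle : ∀ n, ∫⁻ z in K, ‖m z * s n (Φ z) - m z * w (Φ z)‖ₑ ≤
        C * (c * ∫⁻ y in Φ '' K, ‖s n y - w y‖ₑ) := by
      intro n
      calc ∫⁻ z in K, ‖m z * s n (Φ z) - m z * w (Φ z)‖ₑ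
          ≤ ∫⁻ z in K, C * ‖s n (Φ z) - w (Φ z)‖ₑ := by
            refine lintegral_mono_ae ?_
            filter_upwards [hC] with z hz
            rw [← mul_sub, enorm_mul]
            gcongr
            rw [enorm_eq_nnnorm]
            exact_mod_cast hz
        _ = C * ∫⁻ z in K, ‖s n (Φ z) - w (Φ z)‖ₑ := lintegral_const_mul' _ _ (by simp)
        _ ≤ _ := by
            gcongr
            exact h.lintegral_comp_le hW hK hKW (w := fun y => ‖s n y - w y‖ₑ)
              ((hs n).aestronglyMeasurable.sub hw.aestronglyMeasurable).enorm
    refine tendsto_of_tendsto_of_tendsto_of_le_of_le tendsto_const_nhds ?_ (fun _ => zero_le) hle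
    have := ENNReal.Tendsto.const_mul (a := (C : ℝ≥0∞))
      (ENNReal.Tendsto.const_mul (a := (c : ℝ≥0∞)) hlim (.inr (by simp))) (.inr (by simp))
    simpa using this

/-- The chain rule for a weakly differentiable outer function. -/
lemma IsWeakDirDeriv.comp {ι : Type*} [Fintype ι] {e : ι → H} {ℓ : ι → H →L[ℝ] ℝ}
    (hℓ : ∀ y, ∑ j, ℓ j y • e j = y) {u : H → ℝ} {w : ι → H → ℝ} {g : G → H} {v : G}
    (hW : IsOpen W) (hU : IsOpen U) (hΦ : IsPullbackMap c W U Φ)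
    (huU : LocallyIntegrableOn u U) (hu : ∀ j, IsWeakDirDeriv U (e j) u (w j))
    (h : IsWeakDirDeriv W v Φ g) {B : ℝ} (hB : ∀ᵐ x ∂volume.restrict W, ‖Φ x‖ ≤ B)
    (hB' : ∀ᵐ x ∂volume.restrict W, ‖g x‖ ≤ B) :
    IsWeakDirDeriv W v (fun z => u (Φ z)) (fun z => ∑ j, w j (Φ z) * ℓ j (g z)) := by
  have hWm := hW.measurableSet
  have hgm := h.right.aestronglyMeasurable
  have hloc : ∀ {q : H → ℝ}, LocallyIntegrableOn q U →
      LocallyIntegrableOn (fun z => q (Φ z)) W := fun hq =>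
    (locallyIntegrableOn_iff hW.isLocallyClosed).2 fun k hkW hk =>
      hΦ.integrableOn_comp hWm hk hkW hq
  have hℓm : ∀ j, AEStronglyMeasurable (fun z => ℓ j (g z)) (volume.restrict W) := fun j =>
    (ℓ j).continuous.comp_aestronglyMeasurable hgm
  have hℓB : ∀ j, ∀ᵐ z ∂volume.restrict W, ‖ℓ j (g z)‖ ≤ ‖ℓ j‖ * B := fun j =>
    hB'.mono fun z hz => (ContinuousLinearMap.le_opNorm _ _).trans (by gcongr)
  have i1 : ∀ j, LocallyIntegrableOn (fun z => w j (Φ z) * ℓ j (g z)) W := fun j =>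
    LocallyIntegrableOn.mul_ae_bounded hW (hloc (hu j).right) (hℓm j) (hℓB j)
  have i2 : LocallyIntegrableOn (fun z => ∑ j, w j (Φ z) * ℓ j (g z)) W :=
    (locallyIntegrableOn_iff hW.isLocallyClosed).2 fun k hkW hk =>
      integrable_finsetSum _ fun j _ => (i1 j).integrableOn_compact_subset hkW hk
  refine ⟨hloc huU, i2, fun φ hφ hc hs => ?_⟩
  set K := tsupport φ with hKdef
  have hK : IsCompact K := hc
  have hT := hK.image_of_continuousOn (hΦ.continuousOn.mono hs)
  have hTU : Φ '' K ⊆ U := image_subset_iff.2 fun z hz => hΦ.mapsTo (hs hz)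
  obtain ⟨s, sd, sl, sl'⟩ := exists_smooth_approx_lintegral huU hu hU hT hTU
  obtain ⟨C, hC0, hC, hC'⟩ := HasCompactSupport.exists_bound_self_and_fderiv hφ hc v
  lift C to ℝ≥0 using hC0
  have z0 : ∀ z ∉ K, φ z = 0 := fun z hz => image_eq_zero_of_notMem_tsupport hz
  have z1 : ∀ z ∉ K, fderiv ℝ φ z v = 0 := fun z hz => fderiv_apply_eq_zero_of_notMem_tsupport hz
  have dφ : Continuous fun z => fderiv ℝ φ z v :=
    (hφ.continuous_fderiv (by simp)).clm_apply continuous_const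
  have ds : ∀ n j, Continuous fun z => fderiv ℝ (s n) z (e j) := fun n j =>
    ((sd n).continuous_fderiv (by simp)).clm_apply continuous_const
  have hmj : ∀ j, AEStronglyMeasurable (fun z => φ z * ℓ j (g z)) (volume.restrict K) := fun j =>
    hφ.continuous.aestronglyMeasurable.mul
      ((hℓm j).mono_measure (Measure.restrict_mono hs le_rfl))
  have hCj : ∀ j, ∀ᵐ z ∂volume.restrict K, ‖φ z * ℓ j (g z)‖ ≤ (C * (‖ℓ j‖₊ * B.toNNReal) : ℝ≥0) := by
    intro j
    filter_upwards [ae_restrict_of_ae_restrict_of_subset hs (hℓB j)] with z hz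
    rw [norm_mul]
    push_cast
    refine mul_le_mul (hC z) (hz.trans ?_) (norm_nonneg _) C.2
    gcongr
    exact Real.le_coe_toNNReal B
  have step : ∀ n, ∫ z in K, fderiv ℝ φ z v * s n (Φ z) =
      -∑ j, ∫ z in K, (φ z * ℓ j (g z)) * fderiv ℝ (s n) (Φ z) (e j) := by
    intro n
    -- The smooth case applied to the approximant `s n`; its derivative along `g z` is then expanded
    -- in the vectors `e j`.
    have key := (h.contDiff_comp hW (sd n) hB hB').integral_eq φ hφ hc hs
    simp only [smul_eq_mul] at key
    rw [setIntegral_eq_setIntegral_of_vanishing hWm hs fun z hz => by simp [z1 z hz],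
      setIntegral_eq_setIntegral_of_vanishing hWm hs fun z hz => by simp [z0 z hz]] at key
    rw [key, ← integral_finsetSum]
    · congr 2; ext z
      conv_lhs => rw [← hℓ (g z)]
      simp only [map_sum, map_smul, smul_eq_mul, Finset.mul_sum]
      exact Finset.sum_congr rfl fun j _ => by ring
    · intro j _
      exact (hΦ.integrableOn_comp hWm hK hs
        ((ds n j).locallyIntegrable.locallyIntegrableOn U)).bdd_mul (hmj j) (hCj j)
  have lim1 := hΦ.tendsto_integral_mul_comp hWm hK hs huU (fun n => (sd n).continuous) sl
    dφ.aestronglyMeasurable (.of_forall hC')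
  have lim2 := (tendsto_finsetSum Finset.univ fun j _ => hΦ.tendsto_integral_mul_comp hWm hK hs
    (hu j).right (fun n => ds n j) (sl' j) (hmj j) (hCj j)).neg
  simp only [step] at lim1
  simp only [smul_eq_mul]
  rw [setIntegral_eq_setIntegral_of_vanishing hWm hs fun z hz => by simp [z1 z hz],
    setIntegral_eq_setIntegral_of_vanishing hWm hs fun z hz => by simp [z0 z hz],
    tendsto_nhds_unique lim1 lim2, ← integral_finsetSum]
  · congr 2; ext z
    rw [Finset.mul_sum]
    exact Finset.sum_congr rfl fun j _ => by ring
  · intro j _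
    exact (hΦ.integrableOn_comp hWm hK hs (hu j).right).bdd_mul (hmj j) (hCj j)

end Composition

/-! ### Measure bound for deformations. -/

section Deformation

instance isAddHaarMeasure_volume_ST (d : ℕ) : (volume : Measure (ST d)).IsAddHaarMeasure :=
  inferInstanceAs ((volume : Measure (EuclideanSpace ℝ (Fin d))).prod
    (volume : Measure ℝ)).IsAddHaarMeasure

/-- The inverse of `f` is `L`-Lipschitz on `f '' A`, so Hausdorff measure grows by at most `L ^ n`.
By uniqueness of Haar measure, `volume` is a multiple of Hausdorff measure, and the factor cancels.
-/
lemma volume_le_of_antilipschitzOn {V : Type*} [NormedAddCommGroup V] [InnerProductSpace ℝ V]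
    [FiniteDimensional ℝ V] [MeasurableSpace V] [BorelSpace V] {L : ℝ≥0} {f : V → V} {A : Set V}
    (hf : ∀ x ∈ A, ∀ y ∈ A, ‖x - y‖ ≤ L * ‖f x - f y‖) :
    volume A ≤ L ^ Module.finrank ℝ V * volume (f '' A) := by
  have hinj : InjOn f A := fun x hx y hy hxy => by
    have := hf x hx y hy
    rw [hxy, sub_self, norm_zero, mul_zero] at this
    exact sub_eq_zero.1 (norm_le_zero_iff.1 this)
  have hleft : LeftInvOn (Function.invFunOn f A) f A := hinj.leftInvOn_invFunOn
  have hlip : LipschitzOnWith L (Function.invFunOn f A) (f '' A) := by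
    refine LipschitzOnWith.of_dist_le_mul ?_
    rintro _ ⟨x, hx, rfl⟩ _ ⟨y, hy, rfl⟩
    rw [hleft hx, hleft hy, dist_eq_norm, dist_eq_norm]
    exact hf x hx y hy
  have h := hlip.hausdorffMeasure_image_le (d := Module.finrank ℝ V) (by positivity)
  rw [hleft.image_image] at h
  rw [Measure.isAddLeftInvariant_eq_smul (volume : Measure V)
    (Measure.hausdorffMeasure (Module.finrank ℝ V))]
  simp only [Measure.smul_apply, Measure.nnreal_smul_coe_apply]
  rw [ENNReal.rpow_natCast] at h
  calc _ ≤ _ := mul_le_mul_right h _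
    _ = _ := by ring

variable {d : ℕ} {L : ℝ≥0} {E : Set (ST d)} {Ψ : ST d → EuclideanSpace ℝ (Fin d)}

lemma IsDeformation.isPullbackMap (h : IsDeformation L E Ψ) :
    IsPullbackMap (L ^ d) E (spaceTimeMap Ψ '' E) (spaceTimeMap Ψ) := by
  refine ⟨h.continuousOn, mapsTo_image _ _, Measure.le_iff.2 fun s hs => ?_⟩
  set Φ := spaceTimeMap Ψ with hΦ
  have hE := h.isOpen_domain.measurableSet
  have hU := h.isOpen_image.measurableSet
  have hA : MeasurableSet (Φ ⁻¹' s ∩ E) := by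
    have : Φ ⁻¹' s ∩ E = Subtype.val '' (E.domRestrict Φ ⁻¹' s) := by
      ext z; simp [and_comm, Set.domRestrict]
    rw [this]
    exact hE.subtype_image ((continuousOn_iff_continuous_domRestrict.1 h.continuousOn).measurable hs)
  rw [Measure.map_apply_of_aemeasurable (h.continuousOn.aemeasurable hE) hs,
    Measure.restrict_apply' hE, Measure.smul_apply, Measure.restrict_apply hs]
  change (volume.prod volume) _ ≤ _ • (volume.prod volume) _
  -- Slice at fixed `t`: as `Φ` preserves time, each slice of the preimage is mapped into the slice
  -- of `s` at the same `t`.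
  rw [Measure.prod_apply_symm hA, Measure.prod_apply_symm (hs.inter hU), ENNReal.smul_def,
    smul_eq_mul, ← lintegral_const_mul' _ _ (by simp)]
  refine lintegral_mono fun t => ?_
  have := volume_le_of_antilipschitzOn (L := L) (f := fun x => Ψ (x, t))
    (A := (fun x => (x, t)) ⁻¹' (Φ ⁻¹' s ∩ E)) fun x hx y hy => h.antilipschitz t x y hx.2 hy.2
  refine this.trans ?_
  simp only [finrank_euclideanSpace, Fintype.card_fin, ENNReal.coe_pow]
  gcongr
  rintro _ ⟨x, hx, rfl⟩
  exact ⟨hx.1, mem_image_of_mem Φ hx.2⟩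

end Deformation

/-! ### Multi-indices versus iterated directional derivatives. -/

section MultiIndices

variable {d : ℕ}

/-- The multi-index of the first-order derivative in time (`none`) or in a space coordinate. -/
def dirIdx : Option (Fin d) → MIdx d
  | none => idxT d
  | some i => idxX i

/-- The coordinate vectors of space-time. -/
noncomputable def dirVec : Option (Fin d) → ST d
  | none => (0, 1)
  | some i => (EuclideanSpace.single i 1, 0)

/-- The coordinate functionals of space-time. -/
noncomputable def dirCoord : Option (Fin d) → ST d →L[ℝ] ℝ
  | none => ContinuousLinearMap.snd ℝ _ _
  | some i => (EuclideanSpace.proj i).comp (ContinuousLinearMap.fst ℝ _ _)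

lemma sum_dirCoord_smul_dirVec (y : ST d) : ∑ j, dirCoord j y • dirVec j = y := by
  rw [Fintype.sum_option]
  refine Prod.ext ?_ ?_
  · ext i
    simp [dirCoord, dirVec, Prod.fst_sum, Pi.single_apply]
  · simp [dirCoord, dirVec, Prod.snd_sum]

lemma norm_dirCoord_apply_le (e : Option (Fin d)) (y : ST d) : ‖dirCoord e y‖ ≤ ‖y‖ := by
  cases e with
  | none => exact norm_snd_le y
  | some i => exact (PiLp.norm_apply_le y.1 i).trans (norm_fst_le y)

/-- The classical derivative in a coordinate direction. -/
noncomputable def partialDir (e : Option (Fin d)) (φ : ST d → ℝ) : ST d → ℝ :=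
  fun z => fderiv ℝ φ z (dirVec e)

lemma contDiff_partialDir {φ : ST d → ℝ} (hφ : ContDiff ℝ ∞ φ) (e : Option (Fin d)) :
    ContDiff ℝ ∞ (partialDir e φ) :=
  (hφ.fderiv_right (m := ∞) (by simp)).clm_apply contDiff_const

lemma tsupport_partialDir_subset (φ : ST d → ℝ) (e : Option (Fin d)) :
    tsupport (partialDir e φ) ⊆ tsupport φ :=
  tsupport_fderiv_apply_subset ℝ _

lemma partialDir_comm {φ : ST d → ℝ} (hφ : ContDiff ℝ ∞ φ) (e e' : Option (Fin d)) :
    partialDir e (partialDir e' φ) = partialDir e' (partialDir e φ) := by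
  have hd : Differentiable ℝ (fderiv ℝ φ) :=
    (hφ.fderiv_right (m := ∞) (by simp)).differentiable (by simp)
  have key : ∀ (a b : Option (Fin d)) z,
      partialDir a (partialDir b φ) z = fderiv ℝ (fderiv ℝ φ) z (dirVec a) (dirVec b) := by
    intro a b z
    have := ((hd z).hasFDerivAt.clm_apply (hasFDerivAt_const (dirVec b) z)).fderiv
    change fderiv ℝ (fun y => fderiv ℝ φ y (dirVec b)) z (dirVec a) = _
    rw [this]; simp
  ext z
  rw [key, key]
  exact (hφ.contDiffAt.isSymmSndFDerivAt
    (by simpa using WithTop.coe_le_coe.2 (le_top : (2 : ℕ∞) ≤ ⊤))).eq _ _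

/-- The space part of a classical derivative, restricted to the coordinates in a list. -/
noncomputable def spaceDeriv (l : List (Fin d)) (α : Fin d → ℕ) (φ : ST d → ℝ) : ST d → ℝ :=
  l.foldr (fun i f => (partialX i)^[α i] f) φ

lemma classicalDeriv_eq (a : MIdx d) (φ : ST d → ℝ) :
    classicalDeriv a φ = spaceDeriv (List.finRange d) a.1 (partialT^[a.2] φ) := rfl

lemma iterate_partialDir_rel {R : (ST d → ℝ) → (ST d → ℝ) → Prop} {e : Option (Fin d)}
    (hR : ∀ φ ψ, R φ ψ → R (partialDir e φ) (partialDir e ψ)) (n : ℕ) {φ ψ : ST d → ℝ}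
    (h : R φ ψ) : R ((partialDir e)^[n] φ) ((partialDir e)^[n] ψ) := by
  induction n generalizing φ ψ with
  | zero => exact h
  | succ n ih => exact ih (hR _ _ h)

lemma spaceDeriv_rel {R : (ST d → ℝ) → (ST d → ℝ) → Prop}
    (hR : ∀ e φ ψ, R φ ψ → R (partialDir e φ) (partialDir e ψ)) (l : List (Fin d)) (α : Fin d → ℕ)
    {φ ψ : ST d → ℝ} (h : R φ ψ) : R (spaceDeriv l α φ) (spaceDeriv l α ψ) := by
  induction l with
  | nil => exact h
  | cons i l ih => exact iterate_partialDir_rel (hR (some i)) (α i) ih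

/-- One induction for everything stable under single partial derivatives: smoothness, support and
commutation are instances of `R`. -/
lemma classicalDeriv_rel {R : (ST d → ℝ) → (ST d → ℝ) → Prop}
    (hR : ∀ e φ ψ, R φ ψ → R (partialDir e φ) (partialDir e ψ)) (a : MIdx d)
    {φ ψ : ST d → ℝ} (h : R φ ψ) : R (classicalDeriv a φ) (classicalDeriv a ψ) :=
  spaceDeriv_rel hR _ _ (iterate_partialDir_rel (hR none) a.2 h)

lemma contDiff_classicalDeriv {φ : ST d → ℝ} (hφ : ContDiff ℝ ∞ φ) (a : MIdx d) :
    ContDiff ℝ ∞ (classicalDeriv a φ) :=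
  classicalDeriv_rel (R := fun φ _ => ContDiff ℝ ∞ φ)
    (fun e _ _ h => contDiff_partialDir h e) a (ψ := φ) hφ

lemma tsupport_classicalDeriv_subset (φ : ST d → ℝ) (a : MIdx d) :
    tsupport (classicalDeriv a φ) ⊆ tsupport φ :=
  classicalDeriv_rel (R := fun ψ _ => tsupport ψ ⊆ tsupport φ)
    (fun e _ _ h => (tsupport_partialDir_subset _ e).trans h) a (ψ := φ) subset_rfl

lemma partialDir_rel_step (e : Option (Fin d)) (e' : Option (Fin d)) (φ ψ : ST d → ℝ)
    (h : ContDiff ℝ ∞ φ ∧ ψ = partialDir e φ) :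
    ContDiff ℝ ∞ (partialDir e' φ) ∧ partialDir e' ψ = partialDir e (partialDir e' φ) :=
  ⟨contDiff_partialDir h.1 e', by rw [h.2, partialDir_comm h.1]⟩

lemma classicalDeriv_partialDir {φ : ST d → ℝ} (hφ : ContDiff ℝ ∞ φ) (a : MIdx d)
    (e : Option (Fin d)) : classicalDeriv a (partialDir e φ) = partialDir e (classicalDeriv a φ) :=
  (classicalDeriv_rel (R := fun φ ψ => ContDiff ℝ ∞ φ ∧ ψ = partialDir e φ)
    (partialDir_rel_step e) a ⟨hφ, rfl⟩).2

lemma spaceDeriv_add_single_of_notMem {l : List (Fin d)} {i : Fin d} (hi : i ∉ l) (α : Fin d → ℕ)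
    (φ : ST d → ℝ) : spaceDeriv l (α + Pi.single i 1) φ = spaceDeriv l α φ := by
  induction l with
  | nil => rfl
  | cons j l ih =>
    rw [List.mem_cons, not_or] at hi
    change (partialX j)^[_] (spaceDeriv l (α + Pi.single i 1) φ) =
      (partialX j)^[α j] (spaceDeriv l α φ)
    rw [ih hi.2]
    simp [Pi.single_eq_of_ne (Ne.symm hi.1)]

/-- Without repetitions, `i` occurs exactly once in the list, so exactly one extra derivative
appears; it commutes inward past the others. -/
lemma spaceDeriv_add_single {l : List (Fin d)} (hl : l.Nodup) {i : Fin d} (hi : i ∈ l)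
    (α : Fin d → ℕ) {φ : ST d → ℝ} (hφ : ContDiff ℝ ∞ φ) :
    spaceDeriv l (α + Pi.single i 1) φ = spaceDeriv l α (partialDir (some i) φ) := by
  induction l with
  | nil => simp at hi
  | cons j l ih =>
    rw [List.nodup_cons] at hl
    change (partialX j)^[_] (spaceDeriv l (α + Pi.single i 1) φ) =
      (partialX j)^[α j] (spaceDeriv l α (partialDir (some i) φ))
    by_cases hij : i = j
    · subst hij
      rw [spaceDeriv_add_single_of_notMem hl.1]
      have hc := (spaceDeriv_rel (R := fun φ ψ => ContDiff ℝ ∞ φ ∧ ψ = partialDir (some i) φ)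
        (partialDir_rel_step (some i)) l α ⟨hφ, rfl⟩).2
      rw [hc]
      simp only [Pi.add_apply, Pi.single_eq_same, Function.iterate_succ_apply]
      rfl
    · rw [ih hl.2 ((List.mem_cons.1 hi).resolve_left hij)]
      simp [Pi.single_eq_of_ne (Ne.symm hij)]

lemma classicalDeriv_add_dirIdx {φ : ST d → ℝ} (hφ : ContDiff ℝ ∞ φ) (a : MIdx d)
    (e : Option (Fin d)) : classicalDeriv (a + dirIdx e) φ = classicalDeriv a (partialDir e φ) := by
  cases e with
  | none => simp [classicalDeriv_eq, dirIdx, idxT, Function.iterate_succ_apply]; rfl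
  | some i =>
    have h := iterate_partialDir_rel (R := fun φ ψ => ContDiff ℝ ∞ φ ∧ ψ = partialDir (some i) φ)
      (partialDir_rel_step (some i) none) a.2 ⟨hφ, rfl⟩
    change spaceDeriv _ (a.1 + Pi.single i 1) (partialT^[a.2 + 0] φ) =
      spaceDeriv _ a.1 ((partialDir none)^[a.2] (partialDir (some i) φ))
    rw [h.2, add_zero]
    exact spaceDeriv_add_single (List.nodup_finRange d) (List.mem_finRange i) a.1 h.1

lemma classicalDeriv_zero (φ : ST d → ℝ) : classicalDeriv 0 φ = φ := by
  have : ∀ l : List (Fin d), spaceDeriv l 0 φ = φ := by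
    intro l
    induction l with
    | nil => rfl
    | cons j l ih => exact ih
  exact this _

lemma totalOrder_add (a b : MIdx d) : totalOrder (a + b) = totalOrder a + totalOrder b := by
  simp [totalOrder, spaceOrder, Finset.sum_add_distrib]; ring

lemma totalOrder_dirIdx (e : Option (Fin d)) : totalOrder (dirIdx e) = 1 := by
  cases e <;> simp [totalOrder, spaceOrder, dirIdx, idxT, idxX]

lemma totalOrder_zero : totalOrder (0 : MIdx d) = 0 := by
  simp [totalOrder, spaceOrder]

variable {F : Type*} [NormedAddCommGroup F] [NormedSpace ℝ F] {W : Set (ST d)} {f g w : ST d → F}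

lemma hasWeakDeriv_dirIdx_iff {e : Option (Fin d)} :
    HasWeakDeriv W (dirIdx e) f g ↔ IsWeakDirDeriv W (dirVec e) f g := by
  have key : ∀ φ : ST d → ℝ, ContDiff ℝ ∞ φ →
      classicalDeriv (dirIdx e) φ = fun z => fderiv ℝ φ z (dirVec e) := fun φ hφ => by
    have := classicalDeriv_add_dirIdx hφ 0 e
    rwa [zero_add, classicalDeriv_zero] at this
  constructor
  · rintro ⟨h1, h2, h3⟩
    refine ⟨h1, h2, fun φ hφ hc hs => ?_⟩
    simpa [key φ hφ, totalOrder_dirIdx] using h3 φ hφ hc hs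
  · rintro ⟨h1, h2, h3⟩
    refine ⟨h1, h2, fun φ hφ hc hs => ?_⟩
    simpa [key φ hφ, totalOrder_dirIdx] using h3 φ hφ hc hs

/-- Test the first hypothesis with `partialDir e φ`, the second with `φ`, and cancel the sign `(-1)
^ totalOrder a`. -/
lemma HasWeakDeriv.dir_of_add {a : MIdx d} {e : Option (Fin d)} (h : HasWeakDeriv W a f g)
    (h' : HasWeakDeriv W (a + dirIdx e) f w) : HasWeakDeriv W (dirIdx e) g w := by
  rw [hasWeakDeriv_dirIdx_iff]
  refine ⟨h.2.1, h'.2.1, fun φ hφ hc hs => ?_⟩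
  have hs' := tsupport_partialDir_subset φ e
  have k1 := h.2.2 (partialDir e φ) (contDiff_partialDir hφ e)
    (hc.of_isClosed_subset (isClosed_tsupport _) hs') (hs'.trans hs)
  have k2 := h'.2.2 φ hφ hc hs
  rw [classicalDeriv_add_dirIdx hφ, k1, totalOrder_add, totalOrder_dirIdx, pow_succ, mul_smul] at k2
  have := smul_right_injective F (pow_ne_zero (totalOrder a) (by norm_num : (-1 : ℝ) ≠ 0)) k2
  rw [neg_one_smul] at this
  exact this

/-- Here the derivative `classicalDeriv a φ` is itself the test function for the first-order
identity. -/
lemma HasWeakDeriv.add_dir {a : MIdx d} {e : Option (Fin d)} (h : HasWeakDeriv W (dirIdx e) f g)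
    (h' : HasWeakDeriv W a g w) : HasWeakDeriv W (a + dirIdx e) f w := by
  refine ⟨h.1, h'.2.1, fun φ hφ hc hs => ?_⟩
  have hs' := tsupport_classicalDeriv_subset φ a
  have k1 := (hasWeakDeriv_dirIdx_iff.1 h).integral_eq _ (contDiff_classicalDeriv hφ a)
    (hc.of_isClosed_subset (isClosed_tsupport _) hs') (hs'.trans hs)
  rw [classicalDeriv_add_dirIdx hφ, classicalDeriv_partialDir hφ, totalOrder_add,
    totalOrder_dirIdx, pow_succ', mul_smul, neg_one_smul, ← h'.2.2 φ hφ hc hs]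
  exact k1

lemma hasWeakDeriv_zero_self (hf : LocallyIntegrableOn f W) : HasWeakDeriv W 0 f f :=
  ⟨hf, hf, fun φ _ _ _ => by simp [classicalDeriv_zero, totalOrder_zero]⟩

lemma integrableOn_smul_of_tsupport_subset {φ : ST d → ℝ} (hW : MeasurableSet W)
    (hφ : Continuous φ) (hc : HasCompactSupport φ) (hs : tsupport φ ⊆ W)
    (hf : LocallyIntegrableOn f W) : IntegrableOn (fun z => φ z • f z) W := by
  obtain ⟨C, hC⟩ := hc.exists_bound_of_continuous hφ
  have h1 : IntegrableOn (fun z => φ z • f z) (tsupport φ) :=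
    (hf.integrableOn_compact_subset hs hc).bdd_smul C hφ.aestronglyMeasurable (.of_forall hC)
  refine h1.of_forall_sdiff_eq_zero hW fun z hz => ?_
  simp [image_eq_zero_of_notMem_tsupport hz.2]

lemma HasWeakDeriv.ae_eq [CompleteSpace F] {a : MIdx d} (hW : IsOpen W) (h : HasWeakDeriv W a f g)
    (h' : HasWeakDeriv W a f w) : g =ᵐ[volume.restrict W] w := by
  have key := hW.ae_eq_zero_of_integral_contDiff_smul_eq_zero (μ := volume) (h.2.1.sub h'.2.1) ?_
  · rw [EventuallyEq, ae_restrict_iff' hW.measurableSet]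
    filter_upwards [key] with z hz hzW
    exact sub_eq_zero.1 (hz hzW)
  · intro φ hφ hc hs
    have e := (h.2.2 φ hφ hc hs).symm.trans (h'.2.2 φ hφ hc hs)
    have e' := smul_right_injective F (pow_ne_zero (totalOrder a) (by norm_num : (-1 : ℝ) ≠ 0)) e
    have i1 := integrableOn_smul_of_tsupport_subset hW.measurableSet hφ.continuous hc hs h.2.1
    have i2 := integrableOn_smul_of_tsupport_subset hW.measurableSet hφ.continuous hc hs h'.2.1
    rw [← setIntegral_univ, setIntegral_eq_of_subset_of_forall_sdiff_eq_zero .univ (subset_univ W)]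
    · simp only [Pi.sub_apply, smul_sub]
      rw [integral_sub i1 i2]
      exact sub_eq_zero.2 e'
    · intro z hz
      simp [image_eq_zero_of_notMem_tsupport fun h' => hz.2 (hs h')]

lemma HasWeakDeriv.clm_comp [CompleteSpace F] {a : MIdx d} (hW : MeasurableSet W) (ℓ : F →L[ℝ] ℝ)
    (h : HasWeakDeriv W a f g) : HasWeakDeriv W a (fun z => ℓ (f z)) (fun z => ℓ (g z)) := by
  have hloc : ∀ {q : ST d → F}, LocallyIntegrableOn q W →
      LocallyIntegrableOn (fun z => ℓ (q z)) W := fun hq x hx => by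
    obtain ⟨s, hs, hi⟩ := hq x hx
    exact ⟨s, hs, ℓ.integrable_comp hi⟩
  refine ⟨hloc h.1, hloc h.2.1, fun φ hφ hc hs => ?_⟩
  have hs' := tsupport_classicalDeriv_subset φ a
  have i1 := integrableOn_smul_of_tsupport_subset hW (contDiff_classicalDeriv hφ a).continuous
    (hc.of_isClosed_subset (isClosed_tsupport _) hs') (hs'.trans hs) h.1
  have i2 := integrableOn_smul_of_tsupport_subset hW hφ.continuous hc hs h.2.1
  have k := congrArg ℓ (h.2.2 φ hφ hc hs)
  rw [map_smul, ← ℓ.integral_comp_comm i1, ← ℓ.integral_comp_comm i2] at k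
  simpa only [map_smul] using k

end MultiIndices

/-! ### Recursive Sobolev bounds and composition. -/

section SobolevBounds

variable {d : ℕ} {F : Type*} [NormedAddCommGroup F]

/-- `f` is measurable on `W` with `L^r(W)` norm at most `B`. -/
def LpBound (r : ℝ≥0∞) (W : Set (ST d)) (B : ℝ≥0) (f : ST d → F) : Prop :=
  AEStronglyMeasurable f (volume.restrict W) ∧ eLpNorm f r (volume.restrict W) ≤ B

variable {r : ℝ≥0∞} {W U : Set (ST d)} {B B' : ℝ≥0} {k : ℕ}

lemma LpBound.locallyIntegrableOn {f : ST d → F} (hr : 1 ≤ r) (h : LpBound r W B f) :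
    LocallyIntegrableOn f W :=
  locallyIntegrableOn_of_locallyIntegrable_restrict
    (MemLp.locallyIntegrable ⟨h.1, h.2.trans_lt ENNReal.coe_lt_top⟩ hr)

lemma LpBound.ae_norm_le {f : ST d → F} (h : LpBound ⊤ W B f) :
    ∀ᵐ z ∂volume.restrict W, ‖f z‖ ≤ B := by
  have h2 := h.2
  rw [eLpNorm_exponent_top] at h2
  filter_upwards [ae_le_eLpNormEssSup (f := f) (μ := volume.restrict W)] with z hz
  have := hz.trans h2
  rw [enorm_eq_nnnorm] at this
  exact_mod_cast this

variable [NormedSpace ℝ F] {S : Set (Option (Fin d))}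

/-- `f` has iterated weak derivatives in the directions of `S` up to order `k`, all with `L^r(W)`
norm at most `B`. -/
def SobolevBound (S : Set (Option (Fin d))) (r : ℝ≥0∞) (W : Set (ST d)) :
    ℕ → ℝ≥0 → (ST d → F) → Prop
  | 0, B, f => LpBound r W B f
  | k + 1, B, f => LpBound r W B f ∧
      ∀ e ∈ S, ∃ v, HasWeakDeriv W (dirIdx e) f v ∧ SobolevBound S r W k B v

lemma SobolevBound.lpBound {f : ST d → F} (h : SobolevBound S r W k B f) : LpBound r W B f := by
  cases k with
  | zero => exact h
  | succ k => exact h.1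

lemma SobolevBound.of_succ {f : ST d → F} (h : SobolevBound S r W (k + 1) B f) :
    SobolevBound S r W k B f := by
  induction k generalizing f with
  | zero => exact h.1
  | succ k ih =>
    refine ⟨h.1, fun e he => ?_⟩
    obtain ⟨v, hv, hv'⟩ := h.2 e he
    exact ⟨v, hv, ih hv'⟩

lemma SobolevBound.mono {f : ST d → F} (hB : B ≤ B') (h : SobolevBound S r W k B f) :
    SobolevBound S r W k B' f := by
  have hb : ∀ {f : ST d → F}, LpBound r W B f → LpBound r W B' f := fun h =>
    ⟨h.1, h.2.trans (by exact_mod_cast hB)⟩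
  induction k generalizing f with
  | zero => exact hb h
  | succ k ih =>
    refine ⟨hb h.1, fun e he => ?_⟩
    obtain ⟨v, hv, hv'⟩ := h.2 e he
    exact ⟨v, hv, ih hv'⟩

lemma HasWeakDeriv.add {f g f' g' : ST d → F} {a : MIdx d} (hW : MeasurableSet W)
    (hf : HasWeakDeriv W a f f') (hg : HasWeakDeriv W a g g') :
    HasWeakDeriv W a (fun z => f z + g z) (fun z => f' z + g' z) := by
  refine ⟨hf.1.add hg.1, hf.2.1.add hg.2.1, fun φ hφ hc hs => ?_⟩
  have hs' := tsupport_classicalDeriv_subset φ a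
  have hi : ∀ {q : ST d → F}, LocallyIntegrableOn q W →
      IntegrableOn (fun z => classicalDeriv a φ z • q z) W := fun hq =>
    integrableOn_smul_of_tsupport_subset hW (contDiff_classicalDeriv hφ a).continuous
      (hc.of_isClosed_subset (isClosed_tsupport _) hs') (hs'.trans hs) hq
  have hi' : ∀ {q : ST d → F}, LocallyIntegrableOn q W →
      IntegrableOn (fun z => φ z • q z) W := fun hq =>
    integrableOn_smul_of_tsupport_subset hW hφ.continuous hc hs hq
  simp only [smul_add]
  rw [integral_add (hi hf.1) (hi hg.1), integral_add (hi' hf.2.1) (hi' hg.2.1), smul_add,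
    hf.2.2 φ hφ hc hs, hg.2.2 φ hφ hc hs]

lemma SobolevBound.add {f g : ST d → F} (hW : MeasurableSet W) (hr : 1 ≤ r)
    (hf : SobolevBound S r W k B f) (hg : SobolevBound S r W k B' g) :
    SobolevBound S r W k (B + B') (fun z => f z + g z) := by
  have hb : ∀ {f g : ST d → F}, LpBound r W B f → LpBound r W B' g →
      LpBound r W (B + B') (fun z => f z + g z) := fun hf hg =>
    ⟨hf.1.add hg.1, (eLpNorm_add_le hf.1 hg.1 hr).trans
      (by push_cast; exact add_le_add hf.2 hg.2)⟩
  induction k generalizing f g with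
  | zero => exact hb hf hg
  | succ k ih =>
    refine ⟨hb hf.1 hg.1, fun e he => ?_⟩
    obtain ⟨v, hv, hv'⟩ := hf.2 e he
    obtain ⟨w, hw, hw'⟩ := hg.2 e he
    exact ⟨_, hv.add hW hw, ih hv' hw'⟩

lemma sobolevBound_zero : SobolevBound S r W k B (fun _ => (0 : F)) := by
  have hb : LpBound r W B (fun _ => (0 : F)) := ⟨aestronglyMeasurable_const, by simp⟩
  induction k with
  | zero => exact hb
  | succ k ih =>
    exact ⟨hb, fun e _ => ⟨fun _ => 0,
      ⟨locallyIntegrableOn_zero, locallyIntegrableOn_zero, by simp⟩, ih⟩⟩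

lemma SobolevBound.sum {ι : Type*} {f : ι → ST d → F} (hW : MeasurableSet W) (hr : 1 ≤ r)
    (s : Finset ι) (hf : ∀ j, SobolevBound S r W k B (f j)) :
    SobolevBound S r W k (s.card * B) (fun z => ∑ j ∈ s, f j z) := by
  classical
  induction s using Finset.induction_on with
  | empty => simpa using sobolevBound_zero
  | insert j s hj ih =>
    simp only [Finset.sum_insert hj, Finset.card_insert_of_notMem hj]
    refine ((hf j).add hW hr ih).mono (le_of_eq ?_)
    push_cast; ring

lemma SobolevBound.dirCoord_comp {Φ : ST d → ST d} (hW : MeasurableSet W) (j : Option (Fin d))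
    (h : SobolevBound S r W k B Φ) : SobolevBound S r W k B (fun z => dirCoord j (Φ z)) := by
  have hb : ∀ {Φ : ST d → ST d}, LpBound r W B Φ → LpBound r W B (fun z => dirCoord j (Φ z)) :=
    fun h => ⟨(dirCoord j).continuous.comp_aestronglyMeasurable h.1,
      (eLpNorm_mono fun z => norm_dirCoord_apply_le j _).trans h.2⟩
  induction k generalizing Φ with
  | zero => exact hb h
  | succ k ih =>
    refine ⟨hb h.1, fun e he => ?_⟩
    obtain ⟨v, hv, hv'⟩ := h.2 e he
    exact ⟨_, hv.clm_comp hW (dirCoord j), ih hv'⟩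

lemma LpBound.mul {f h : ST d → ℝ} (hf : LpBound r W B f) (hh : LpBound ⊤ W B' h) :
    LpBound r W (B * B') (fun z => f z * h z) := by
  refine ⟨hf.1.mul hh.1, ?_⟩
  have : ∀ᵐ z ∂volume.restrict W, ‖f z * h z‖₊ ≤ B' * ‖f z‖₊ := by
    filter_upwards [hh.ae_norm_le] with z hz
    rw [nnnorm_mul, mul_comm]
    gcongr
    exact_mod_cast hz
  refine (eLpNorm_le_nnreal_smul_eLpNorm_of_ae_le_mul this r).trans ?_
  rw [ENNReal.smul_def, smul_eq_mul, ENNReal.coe_mul, mul_comm]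
  gcongr
  exact hf.2

/-- Leibniz rule: each differentiation splits a product into two, whence the factor `2 ^ k`. -/
lemma SobolevBound.mul {f h : ST d → ℝ} (hW : IsOpen W) (hr : 1 ≤ r)
    (hf : SobolevBound S r W k B f) (hh : SobolevBound S ⊤ W k B' h) :
    SobolevBound S r W k (2 ^ k * (B * B')) (fun z => f z * h z) := by
  induction k generalizing f h with
  | zero => simpa [SobolevBound] using LpBound.mul hf hh
  | succ k ih =>
    have hle : B * B' ≤ 2 ^ (k + 1) * (B * B') :=
      le_mul_of_one_le_left zero_le (one_le_pow₀ one_le_two)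
    -- A Sobolev bound of order `0` is an `LpBound`, so monotonicity is used at `k := 0`.
    refine ⟨SobolevBound.mono (S := S) (k := 0) hle (hf.1.mul hh.1), fun e he => ?_⟩
    obtain ⟨v, hv, hv'⟩ := hf.2 e he
    obtain ⟨w, hw, hw'⟩ := hh.2 e he
    refine ⟨fun z => v z * h z + f z * w z, ?_, ?_⟩
    · rw [hasWeakDeriv_dirIdx_iff] at hv hw ⊢
      exact hv.mul hW hw hh.1.ae_norm_le hw'.lpBound.ae_norm_le
    · refine ((ih hv' hh.of_succ).add hW.measurableSet hr (ih hf.of_succ hw')).mono (le_of_eq ?_)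
      ring

/-- The first-order derivatives of a composition, with all their derivatives. -/
lemma exists_hasWeakDeriv_comp {c C M : ℝ≥0} {Φ g : ST d → ST d} {u : ST d → ℝ}
    {e : Option (Fin d)} (hW : IsOpen W) (hU : IsOpen U) (hΦ : IsPullbackMap c W U Φ)
    (hcomp : ∀ w : ST d → ℝ, SobolevBound univ 2 U k B w →
      SobolevBound S 2 W k (C * B) (fun z => w (Φ z)))
    (hΦM : LpBound ⊤ W M Φ) (hg : HasWeakDeriv W (dirIdx e) Φ g) (hgM : SobolevBound S ⊤ W k M g)
    (hu : SobolevBound univ 2 U (k + 1) B u) :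
    ∃ v, HasWeakDeriv W (dirIdx e) (fun z => u (Φ z)) v ∧
      SobolevBound S 2 W k ((d + 1) * (2 ^ k * (C * M)) * B) v := by
  choose w hw hw' using fun j => hu.2 j (mem_univ j)
  refine ⟨fun z => ∑ j, w j (Φ z) * dirCoord j (g z), ?_, ?_⟩
  · rw [hasWeakDeriv_dirIdx_iff] at hg ⊢
    exact hg.comp sum_dirCoord_smul_dirVec hW hU hΦ (hu.1.locallyIntegrableOn one_le_two)
      (fun j => hasWeakDeriv_dirIdx_iff.1 (hw j)) hΦM.ae_norm_le hgM.lpBound.ae_norm_le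
  -- There are `d + 1` space-time directions; each product costs `2 ^ k`, with bound `C * B` on the
  -- composed factor and `M` on the component of `g`.
  · refine (SobolevBound.sum hW.measurableSet one_le_two Finset.univ fun j =>
      (hcomp _ (hw' j)).mul hW one_le_two (hgM.dirCoord_comp hW.measurableSet j)).mono
      (le_of_eq ?_)
    simp only [Finset.card_univ, Fintype.card_option, Fintype.card_fin]
    push_cast; ring

/-- Composition with a deformation is bounded between Sobolev spaces. -/
theorem exists_sobolevBound_comp (S : Set (Option (Fin d))) (c M : ℝ≥0) (k : ℕ) :
    ∃ C : ℝ≥0, ∀ (W U : Set (ST d)) (Φ : ST d → ST d), IsOpen W → IsOpen U →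
      IsPullbackMap c W U Φ → SobolevBound S ⊤ W k M Φ → ∀ (B : ℝ≥0) (u : ST d → ℝ),
      SobolevBound univ 2 U k B u → SobolevBound S 2 W k (C * B) (fun z => u (Φ z)) := by
  have hb : ∀ {W U : Set (ST d)} {Φ : ST d → ST d}, IsOpen W → IsPullbackMap c W U Φ →
      ∀ {B : ℝ≥0} {u : ST d → ℝ}, LpBound 2 U B u →
      LpBound 2 W (c ^ (1 / 2 : ℝ) * B) (fun z => u (Φ z)) := fun hW hΦ B u hu =>
    ⟨hΦ.aestronglyMeasurable_comp hW.measurableSet hu.1,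
      (hΦ.eLpNorm_two_comp_le hW.measurableSet hu.1).trans (by
        rw [ENNReal.coe_mul]; gcongr; exact hu.2)⟩
  induction k with
  | zero => exact ⟨c ^ (1 / 2 : ℝ), fun W U Φ hW _ hΦ _ B u hu => hb hW hΦ hu⟩
  | succ k ih =>
    obtain ⟨C, hC⟩ := ih
    -- The same bound must serve all orders: the first summand covers the function itself, the
    -- second its derivatives.
    refine ⟨c ^ (1 / 2 : ℝ) + (d + 1) * (2 ^ k * (C * M)),
      fun W U Φ hW hU hΦ hΦM B u hu => ⟨?_, fun e he => ?_⟩⟩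
    · exact SobolevBound.mono (S := S) (k := 0) (by gcongr; exact le_self_add) (hb hW hΦ hu.1)
    · obtain ⟨g, hg, hgM⟩ := hΦM.2 e he
      obtain ⟨v, hv, hv'⟩ := exists_hasWeakDeriv_comp hW hU hΦ
        (fun w hw => hC W U Φ hW hU hΦ hΦM.of_succ B w hw) hΦM.1 hg hgM hu
      exact ⟨v, hv, hv'.mono (by gcongr; exact le_add_self)⟩

end SobolevBounds

/-! ### From multi-index norms to recursive bounds and back. -/

section Norms

variable {d : ℕ} {F : Type*} [NormedAddCommGroup F] [NormedSpace ℝ F]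
variable {S : Set (Option (Fin d))} {r : ℝ≥0∞} {W : Set (ST d)} {B : ℝ≥0} {k l : ℕ}

/-- The multi-indices of order at most `k` that involve only the directions in `S`. -/
def dirIdxSet (S : Set (Option (Fin d))) : ℕ → Set (MIdx d)
  | 0 => {0}
  | k + 1 => {0} ∪ {a | ∃ e ∈ S, ∃ b ∈ dirIdxSet S k, a = b + dirIdx e}

lemma zero_mem_dirIdxSet : (0 : MIdx d) ∈ dirIdxSet S k := by
  cases k with
  | zero => exact rfl
  | succ k => exact .inl rfl

/-- All derivatives come from one family indexed by multi-indices, so `w (a + dirIdx e)` is a weak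
derivative of `w a` and the induction can move the base point `a`. -/
lemma sobolevBound_of_family {f : ST d → F} {w : MIdx d → ST d → F} {a : MIdx d}
    (h : ∀ b ∈ dirIdxSet S k, HasWeakDeriv W (a + b) f (w (a + b)) ∧
      eLpNorm (w (a + b)) r (volume.restrict W) ≤ B) : SobolevBound S r W k B (w a) := by
  have hb : LpBound r W B (w a) := by
    have := h 0 zero_mem_dirIdxSet
    rw [add_zero] at this
    exact ⟨this.1.2.1.aestronglyMeasurable, this.2⟩
  induction k generalizing a with
  | zero => exact hb
  | succ k ih =>
    refine ⟨hb, fun e he => ⟨w (a + dirIdx e), ?_, ?_⟩⟩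
    · have h0 := (h 0 zero_mem_dirIdxSet).1
      have h1 := (h (dirIdx e) (.inr ⟨e, he, 0, zero_mem_dirIdxSet, (zero_add _).symm⟩)).1
      rw [add_zero] at h0
      exact h0.dir_of_add h1
    · have key : ∀ b ∈ dirIdxSet S k, HasWeakDeriv W (a + dirIdx e + b) f (w (a + dirIdx e + b)) ∧
          eLpNorm (w (a + dirIdx e + b)) r (volume.restrict W) ≤ B := by
        intro b hb
        have := h (b + dirIdx e) (.inr ⟨e, he, b, hb, rfl⟩)
        rwa [add_comm b, ← add_assoc] at this
      refine ih key ?_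
      have := key 0 zero_mem_dirIdxSet
      rw [add_zero] at this
      exact ⟨this.1.2.1.aestronglyMeasurable, this.2⟩

/-- Weak derivatives agree almost everywhere, so the infimum is attained by any of them. -/
lemma exists_of_weakDerivNorm_le [CompleteSpace F] {f : ST d → F} {a : MIdx d} (hW : IsOpen W)
    (h : weakDerivNorm r W a f ≤ B) :
    ∃ v, HasWeakDeriv W a f v ∧ eLpNorm v r (volume.restrict W) ≤ B := by
  have hlt : weakDerivNorm r W a f < ⊤ := h.trans_lt ENNReal.coe_lt_top
  simp only [weakDerivNorm, iInf_lt_iff] at hlt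
  obtain ⟨v, hv, -⟩ := hlt
  refine ⟨v, hv, le_trans ?_ h⟩
  exact le_iInf₂ fun w hw => (eLpNorm_congr_ae (hv.ae_eq hW hw)).le

lemma sobolevBound_of_weakDerivNorm_le [CompleteSpace F] {f : ST d → F} (hW : IsOpen W)
    (h : ∀ b ∈ dirIdxSet S k, weakDerivNorm r W b f ≤ B) : SobolevBound S r W k B f := by
  classical
  choose! w hw using fun b hb => exists_of_weakDerivNorm_le hW (h b hb)
  have h0 := hw 0 zero_mem_dirIdxSet
  have hself := hasWeakDeriv_zero_self h0.1.1
  -- The chosen derivative of order zero is only almost everywhere equal to `f`; the update makes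
  -- the family start at `f` itself.
  have := sobolevBound_of_family (f := f) (w := Function.update w 0 f) (a := 0) (S := S) (k := k)
    (r := r) (W := W) (B := B) fun b hb => by
      rw [zero_add]
      by_cases hb0 : b = 0
      · subst hb0
        rw [Function.update_self]
        exact ⟨hself, (eLpNorm_congr_ae (hself.ae_eq hW h0.1)).trans_le h0.2⟩
      · rw [Function.update_of_ne hb0]
        exact hw b hb
  rwa [Function.update_self] at this

lemma SobolevBound.weakDerivNorm_le {f : ST d → F} (hr : 1 ≤ r) (h : SobolevBound S r W k B f)
    {a : MIdx d} (ha : a ∈ dirIdxSet S k) : weakDerivNorm r W a f ≤ B := by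
  suffices ∃ v, HasWeakDeriv W a f v ∧ eLpNorm v r (volume.restrict W) ≤ B by
    obtain ⟨v, hv, hv'⟩ := this
    exact (iInf₂_le v hv).trans hv'
  have h0 : a = 0 → ∃ v, HasWeakDeriv W a f v ∧ eLpNorm v r (volume.restrict W) ≤ B := by
    rintro rfl
    exact ⟨f, hasWeakDeriv_zero_self (h.lpBound.locallyIntegrableOn hr), h.lpBound.2⟩
  induction k generalizing f a with
  | zero => exact h0 ha
  | succ k ih =>
    rcases ha with ha | ⟨e, he, b, hb, rfl⟩
    · exact h0 ha
    · obtain ⟨v, hv, hv'⟩ := h.2 e he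
      obtain ⟨w, hw, hw'⟩ := ih hv' hb (by
        rintro rfl
        exact ⟨v, hasWeakDeriv_zero_self (hv'.lpBound.locallyIntegrableOn hr), hv'.lpBound.2⟩)
      exact ⟨w, hv.add_dir hw, hw'⟩

lemma spaceOrder_eq_zero {a : MIdx d} : spaceOrder a = 0 ↔ a.1 = 0 := by
  simp [spaceOrder, funext_iff]

lemma mem_anisoIdx_zero_left {a : MIdx d} : a ∈ anisoIdx d 0 l ↔ a.1 = 0 ∧ a.2 ≤ l := by
  simp only [anisoIdx, Finset.mem_filter, Finset.mem_product, Fintype.mem_piFinset,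
    Finset.mem_range]
  constructor
  · rintro ⟨⟨h1, h2⟩, -⟩
    exact ⟨funext fun i => by simpa using h1 i, by omega⟩
  · rintro ⟨h1, h2⟩
    refine ⟨⟨fun i => by simp [h1], by omega⟩, ?_⟩
    rw [spaceOrder_eq_zero.2 h1]
    simp only [Nat.cast_zero, ENNReal.zero_div, zero_add]
    exact ENNReal.div_le_of_le_mul (by simpa using h2)

lemma mem_anisoIdx_zero_right {a : MIdx d} : a ∈ anisoIdx d k 0 ↔ a.2 = 0 ∧ spaceOrder a ≤ k := by
  simp only [anisoIdx, Finset.mem_filter, Finset.mem_product, Fintype.mem_piFinset,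
    Finset.mem_range]
  constructor
  · rintro ⟨⟨h1, h2⟩, h3⟩
    have h2' : a.2 = 0 := by omega
    refine ⟨h2', ?_⟩
    rw [h2'] at h3
    simp only [Nat.cast_zero, ENNReal.zero_div, add_zero] at h3
    -- For `k = 0` the quotient cannot be cleared; the a priori box already forces the spatial index
    -- to vanish.
    rcases Nat.eq_zero_or_pos k with rfl | hk
    · exact (spaceOrder_eq_zero.2 (funext fun i => by simpa using h1 i)).le
    · rw [ENNReal.div_le_iff (by simpa using hk.ne') (by simp), one_mul] at h3
      exact_mod_cast h3
  · rintro ⟨h1, h2⟩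
    refine ⟨⟨fun i => ?_, by omega⟩, ?_⟩
    · have : a.1 i ≤ spaceOrder a := Finset.single_le_sum (fun j _ => Nat.zero_le (a.1 j))
        (Finset.mem_univ i)
      omega
    · rw [h1]
      simp only [Nat.cast_zero, ENNReal.zero_div, add_zero]
      exact ENNReal.div_le_of_le_mul (by simpa using h2)

lemma dirIdxSet_none : dirIdxSet {none} l = {a : MIdx d | a ∈ anisoIdx d 0 l} := by
  simp only [mem_anisoIdx_zero_left]
  induction l with
  | zero =>
    ext a
    simp [dirIdxSet, Prod.ext_iff]
  | succ l ih =>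
    ext a
    simp only [dirIdxSet, ih]
    constructor
    · rintro (rfl | ⟨e, rfl, b, ⟨hb1, hb2⟩, rfl⟩)
      · simp
      · exact ⟨by simp [hb1, dirIdx, idxT], by simpa [dirIdx, idxT] using hb2⟩
    · rintro ⟨h1, h2⟩
      rcases hp : a.2 with _ | p
      · exact .inl (Prod.ext h1 hp)
      · exact .inr ⟨none, rfl, (0, p), ⟨rfl, by simp only; omega⟩,
          Prod.ext (by simp [h1, dirIdx, idxT]) (by simp [hp, dirIdx, idxT])⟩

lemma spaceOrder_add (a b : MIdx d) : spaceOrder (a + b) = spaceOrder a + spaceOrder b := by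
  simp [spaceOrder, Finset.sum_add_distrib]

lemma dirIdxSet_some : dirIdxSet (range some) k = {a : MIdx d | a ∈ anisoIdx d k 0} := by
  simp only [mem_anisoIdx_zero_right]
  have hX : ∀ i : Fin d, spaceOrder (dirIdx (some i)) = 1 := fun i => by
    simp [spaceOrder, dirIdx, idxX]
  induction k with
  | zero =>
    ext a
    simp [dirIdxSet, Prod.ext_iff, spaceOrder_eq_zero, and_comm]
  | succ k ih =>
    ext a
    simp only [dirIdxSet, ih]
    constructor
    · rintro (rfl | ⟨_, ⟨i, rfl⟩, b, ⟨hb1, hb2⟩, rfl⟩)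
      · simp [spaceOrder]
      · exact ⟨by simp [hb1, dirIdx, idxX], by rw [spaceOrder_add, hX]; omega⟩
    · rintro ⟨h1, h2⟩
      by_cases h : a.1 = 0
      · exact .inl (Prod.ext h h1)
      · obtain ⟨i, hi⟩ := Function.ne_iff.1 h
        have hi' : 1 ≤ a.1 i := Nat.one_le_iff_ne_zero.2 hi
        have hadd : a = (a.1 - Pi.single i 1, 0) + dirIdx (some i) := by
          refine Prod.ext (funext fun j => ?_) (by simp [h1, dirIdx, idxX])
          by_cases hij : j = i
          · subst hij; simp [dirIdx, idxX]; omega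
          · simp [dirIdx, idxX, Pi.single_eq_of_ne hij]
        refine .inr ⟨some i, ⟨i, rfl⟩, _, ⟨rfl, ?_⟩, hadd⟩
        rw [hadd, spaceOrder_add, hX] at h2
        omega

/-- One inclusion suffices, as the isotropic norm occurs only as an upper bound. -/
lemma dirIdxSet_univ_subset {a : MIdx d} (ha : a ∈ dirIdxSet univ k) : a ∈ isoIdx d k := by
  have key : totalOrder a ≤ k := by
    induction k generalizing a with
    | zero => rw [show a = 0 from ha, totalOrder_zero]
    | succ k ih =>
      rcases ha with rfl | ⟨e, -, b, hb, rfl⟩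
      · simp [totalOrder_zero]
      · rw [totalOrder_add, totalOrder_dirIdx]
        exact Nat.succ_le_succ (ih hb)
  simp only [isoIdx, Finset.mem_filter, Finset.mem_product, Fintype.mem_piFinset,
    Finset.mem_range]
  refine ⟨⟨fun i => ?_, ?_⟩, key⟩
  · have : a.1 i ≤ spaceOrder a := Finset.single_le_sum (fun j _ => Nat.zero_le (a.1 j))
      (Finset.mem_univ i)
    unfold totalOrder at key
    omega
  · unfold totalOrder at key
    omega

lemma sum_sq_rpow_half_le {ι : Type*} (s : Finset ι) {x : ι → ℝ≥0∞} {b : ℝ≥0∞}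
    (h : ∀ i ∈ s, x i ≤ b) :
    (∑ i ∈ s, x i ^ 2) ^ (1 / 2 : ℝ) ≤ ((s.card : ℝ≥0) ^ (1 / 2 : ℝ) : ℝ≥0) * b := by
  calc (∑ i ∈ s, x i ^ 2) ^ (1 / 2 : ℝ) ≤ (s.card * b ^ 2) ^ (1 / 2 : ℝ) := by
        gcongr
        refine (Finset.sum_le_card_nsmul s _ (b ^ 2) fun i hi => by gcongr; exact h i hi).trans ?_
        rw [nsmul_eq_mul]
    _ = _ := by
        rw [ENNReal.mul_rpow_of_nonneg _ _ (by norm_num), ← ENNReal.rpow_natCast,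
          ← ENNReal.rpow_mul, ENNReal.coe_rpow_of_nonneg _ (by norm_num)]
        norm_num

lemma le_sum_sq_rpow_half {ι : Type*} {s : Finset ι} {x : ι → ℝ≥0∞} {i : ι} (hi : i ∈ s) :
    x i ≤ (∑ i ∈ s, x i ^ 2) ^ (1 / 2 : ℝ) := by
  calc x i = (x i ^ 2) ^ (1 / 2 : ℝ) := by
        rw [← ENNReal.rpow_natCast, ← ENNReal.rpow_mul]; norm_num
    _ ≤ _ := by
        gcongr
        exact Finset.single_le_sum (f := fun i => x i ^ 2) (fun j _ => zero_le) hi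

lemma sobolevBound_of_normH_le {u : ST d → ℝ} (hW : IsOpen W) (h : normH k W u ≤ B) :
    SobolevBound univ 2 W k B u :=
  sobolevBound_of_weakDerivNorm_le hW fun _ hb =>
    (le_sum_sq_rpow_half (x := fun a => weakDerivNorm 2 W a u) (dirIdxSet_univ_subset hb)).trans h

lemma sobolevBound_of_normHinf_le {Φ : ST d → ST d} {S : Set (Option (Fin d))} {m : ℕ}
    (hS : dirIdxSet S m = {a | a ∈ anisoIdx d k l}) (hW : IsOpen W) (h : normHinf k l W Φ ≤ B) :
    SobolevBound S ⊤ W m B Φ :=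
  sobolevBound_of_weakDerivNorm_le hW fun _ hb =>
    (Finset.le_sup (f := fun a => weakDerivNorm ⊤ W a Φ) (hS.subset hb)).trans h

lemma SobolevBound.normHaniso_le {u : ST d → ℝ} {S : Set (Option (Fin d))} {m : ℕ}
    (hS : dirIdxSet S m = {a | a ∈ anisoIdx d k l}) (h : SobolevBound S 2 W m B u) :
    normHaniso k l W u ≤ (((anisoIdx d k l).card : ℝ≥0) ^ (1 / 2 : ℝ) : ℝ≥0) * B :=
  sum_sq_rpow_half_le _ fun _ ha => h.weakDerivNorm_le one_le_two (hS.symm.subset ha)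

/-- Reduces to finite norms of the outer function. Since `0 * ⊤ = 0`, the constant must be nonzero
when the norm is infinite. -/
lemma le_coe_mul_of_forall_le {C : ℝ≥0} (hC : C ≠ 0) {x y : ℝ≥0∞}
    (h : ∀ b : ℝ≥0, y ≤ b → x ≤ C * b) : x ≤ C * y := by
  rcases eq_or_ne y ⊤ with rfl | hy
  · rw [ENNReal.mul_top (by simpa using hC)]
    exact le_top
  · lift y to ℝ≥0 using hy
    exact h y le_rfl

end Norms

/-! ### The composition estimates in the original norms. -/

section Composition

variable {d : ℕ}

theorem exists_normHaniso_comp_le {S : Set (Option (Fin d))} {k l m : ℕ}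
    (hS : dirIdxSet S m = {a | a ∈ anisoIdx d k l}) (M L : ℝ≥0) :
    ∃ C : ℝ≥0, ∀ (E : Set (ST d)) (Ψ : ST d → EuclideanSpace ℝ (Fin d)) (u : ST d → ℝ),
      IsDeformation L E Ψ → normHinf k l E (spaceTimeMap Ψ) ≤ M →
      normHaniso k l E (u ∘ spaceTimeMap Ψ) ≤ C * normH m (spaceTimeMap Ψ '' E) u := by
  obtain ⟨C, hC⟩ := exists_sobolevBound_comp S (L ^ d) M m
  -- The `+ 1` keeps the constant positive, as infinite norms require.
  refine ⟨((anisoIdx d k l).card : ℝ≥0) ^ (1 / 2 : ℝ) * C + 1, fun E Ψ u h hM =>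
    le_coe_mul_of_forall_le (by positivity) fun b hb => ?_⟩
  have key := hC E _ _ h.isOpen_domain h.isOpen_image h.isPullbackMap
    (sobolevBound_of_normHinf_le hS h.isOpen_domain hM) b u
    (sobolevBound_of_normH_le h.isOpen_image hb)
  refine (key.normHaniso_le hS).trans ?_
  rw [← ENNReal.coe_mul, ← ENNReal.coe_mul, ENNReal.coe_le_coe, ← mul_assoc]
  gcongr
  exact le_self_add

/-- If `Φ` and its derivative in a coordinate direction are bounded in `H^{k,l,∞}`, the derivative
of `u ∘ Φ` in that direction is bounded in `H^{k,l}`. -/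
theorem exists_normHaniso_deriv_comp_le {S : Set (Option (Fin d))} {k l m : ℕ}
    (hS : dirIdxSet S m = {a | a ∈ anisoIdx d k l}) (M L : ℝ≥0) :
    ∃ C : ℝ≥0, ∀ (E : Set (ST d)) (Ψ : ST d → EuclideanSpace ℝ (Fin d)) (u : ST d → ℝ)
      (e : Option (Fin d)), IsDeformation L E Ψ → normHinf k l E (spaceTimeMap Ψ) ≤ M →
      (⨅ (v : ST d → ST d) (_ : HasWeakDeriv E (dirIdx e) (spaceTimeMap Ψ) v),
        normHinf k l E v) ≤ M →
      (⨅ (v : ST d → ℝ) (_ : HasWeakDeriv E (dirIdx e) (u ∘ spaceTimeMap Ψ) v),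
        normHaniso k l E v) ≤ C * normH (m + 1) (spaceTimeMap Ψ '' E) u := by
  -- The slack `M + 1` allows a derivative of `Φ` to be extracted from an infimum bounded by `M`,
  -- without showing that it is attained.
  obtain ⟨C, hC⟩ := exists_sobolevBound_comp S (L ^ d) (M + 1) m
  refine ⟨((anisoIdx d k l).card : ℝ≥0) ^ (1 / 2 : ℝ) *
    ((d + 1) * (2 ^ m * (C * (M + 1)))) + 1, fun E Ψ u e h hM hM' =>
    le_coe_mul_of_forall_le (by positivity) fun b hb => ?_⟩
  have hlt : (M : ℝ≥0∞) < (M + 1 : ℝ≥0) := by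
    rw [ENNReal.coe_lt_coe]; exact lt_add_one M
  obtain ⟨g, hg, hgM⟩ : ∃ g, HasWeakDeriv E (dirIdx e) (spaceTimeMap Ψ) g ∧
      normHinf k l E g ≤ (M + 1 : ℝ≥0) := by
    have := hM'.trans_lt hlt
    simp only [iInf_lt_iff] at this
    obtain ⟨g, hg, hg'⟩ := this
    exact ⟨g, hg, hg'.le⟩
  have hΦ := sobolevBound_of_normHinf_le hS h.isOpen_domain (hM.trans hlt.le)
  obtain ⟨v, hv, hv'⟩ := exists_hasWeakDeriv_comp h.isOpen_domain h.isOpen_image h.isPullbackMap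
    (fun w hw => hC E _ _ h.isOpen_domain h.isOpen_image h.isPullbackMap hΦ b w hw) hΦ.lpBound hg
    (sobolevBound_of_normHinf_le hS h.isOpen_domain hgM)
    (sobolevBound_of_normH_le h.isOpen_image hb)
  refine (iInf₂_le v hv).trans ((hv'.normHaniso_le hS).trans ?_)
  rw [← ENNReal.coe_mul, ← ENNReal.coe_mul, ENNReal.coe_le_coe, ← mul_assoc]
  gcongr
  exact le_self_add

end Composition

end AnisoSobolev

open AnisoSobolev in
theorem mainTheorem9 (d ls lt : ℕ) (M L : ℝ≥0) :
    (∃ C : ℝ≥0, ∀ (E : Set (ST d)) (Ψ : ST d → EuclideanSpace ℝ (Fin d)) (u : ST d → ℝ),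
      IsDeformation L E Ψ →
      normHinf 0 lt E (spaceTimeMap Ψ) ≤ M →
      normHaniso 0 lt E (u ∘ spaceTimeMap Ψ) ≤ C * normH lt (spaceTimeMap Ψ '' E) u) ∧
    (∃ C : ℝ≥0, ∀ (E : Set (ST d)) (Ψ : ST d → EuclideanSpace ℝ (Fin d)) (u : ST d → ℝ),
      IsDeformation L E Ψ →
      normHinf ls 0 E (spaceTimeMap Ψ) ≤ M →
      normHaniso ls 0 E (u ∘ spaceTimeMap Ψ) ≤ C * normH ls (spaceTimeMap Ψ '' E) u) ∧
    (∃ C : ℝ≥0, ∀ (E : Set (ST d)) (Ψ : ST d → EuclideanSpace ℝ (Fin d)) (u : ST d → ℝ),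
      IsDeformation L E Ψ →
      normHinf ls 0 E (spaceTimeMap Ψ) + normHinfDt ls 0 E (spaceTimeMap Ψ) ≤ M →
      normHanisoDt ls 0 E (u ∘ spaceTimeMap Ψ) ≤ C * normH (ls + 1) (spaceTimeMap Ψ '' E) u) ∧
    (∃ C : ℝ≥0, ∀ (E : Set (ST d)) (Ψ : ST d → EuclideanSpace ℝ (Fin d)) (u : ST d → ℝ),
      IsDeformation L E Ψ →
      normHinf 0 lt E (spaceTimeMap Ψ) + normHinfGrad 0 lt E (spaceTimeMap Ψ) ≤ M →
      normHanisoGrad 0 lt E (u ∘ spaceTimeMap Ψ) ≤ C * normH (lt + 1) (spaceTimeMap Ψ '' E) u) := by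
  refine ⟨exists_normHaniso_comp_le dirIdxSet_none M L, exists_normHaniso_comp_le dirIdxSet_some M L,
    ?_, ?_⟩
  · obtain ⟨C, hC⟩ := exists_normHaniso_deriv_comp_le (dirIdxSet_some (k := ls)) M L
    exact ⟨C, fun E Ψ u h hM => hC E Ψ u none h (le_self_add.trans hM) (le_add_self.trans hM)⟩
  · obtain ⟨C, hC⟩ := exists_normHaniso_deriv_comp_le (dirIdxSet_none (l := lt)) M L
    -- The gradient norm is a Euclidean sum of `d` directional norms, each bounded with the same
    -- `C`; this costs `√d`.
    refine ⟨((Finset.univ : Finset (Fin d)).card : ℝ≥0) ^ (1 / 2 : ℝ) * C, fun E Ψ u h hM => ?_⟩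
    rw [ENNReal.coe_mul, mul_assoc]
    refine sum_sq_rpow_half_le Finset.univ fun i _ => hC E Ψ u (some i) h (le_self_add.trans hM) ?_
    exact (Finset.le_sup (f := fun i : Fin d => ⨅ (v : ST d → ST d)
      (_ : HasWeakDeriv E (idxX i) (spaceTimeMap Ψ) v), normHinf 0 lt E v)
      (Finset.mem_univ i)).trans (le_add_self.trans hM)
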